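/- **Setting.** An operation record is $op=\langle m,\sigma,\sigma',id\rangle$: a method call $m=o.m(\vec x)$ (with its arguments), the thread-local states before and after it (carrying variables and returned values), and an identifier. The shared object is given by a prefix-closed predicate $\mathsf{allowed}$ on finite logs of operations that holds of the empty log and does not depend on identifiers. Operations are deterministic: if $\ell\cdot\langle m,\sigma,\sigma_1\rangle$ and $\ell\cdot\langle m,\sigma,\sigma_2\rangle$ are allowed then $\sigma_1=\sigma_2$. Write $\ell_1\preceq\ell_2$ if for all $s$, $\mathsf{allowed}(\ell_1 s)$ implies $\mathsf{allowed}(\ell_2 s)$; write $a\blacktriangleleft b$ if $\ell ab\preceq\ell ba$ for all $\ell$; $a,b$ *commute* if $a\blacktriangleleft b$ and $b\blacktriangleleft a$. A program is given by a deterministic relation "code $c$ in local state $\sigma$ reaches next the method call $m$, with remaining code $c'$" and a predicate $\mathsf{fin}(c,\sigma)$ ($c$ reduces to $\mathtt{skip}$ without further work), which excludes a next call. There are $N$ transactions $\tau$, with initial code $c_\tau$ and local state $\sigma_\tau$. **Atomic machine.** A configuration has a code and local state for each transaction and one log, initially $(c_\tau,\sigma_\tau)_\tau$ and the empty log. A step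 selects one transaction and runs it to completion, to $\mathtt{skip}$, appending its operations, each allowed by the log so far and with a fresh identifier. Two complete traces $\pi,\pi'$ from the initial configuration are equivalent, $\pi\simeq\pi'$, if their final logs $l',l''$ satisfy $l'\preceq l''$ and $l''\preceq l'$ and their final local states are equal. **Concurrent machine.** A configuration has a thread $\{c,\sigma,L\}$ for each transaction, with $L$ a local log of operations marked unpushed, pushed or pulled (the first two kinds are the thread's own), and a shared log $G$ of operations marked committed or uncommitted; all logs are initially empty. The steps of a running transaction are: - APP: append the next operation to $L$, unpushed and with a fresh identifier, if $L$ allows it; - UNAPP: undo the last entry of $L$ if it is unpushed, restoring code and local state; - PUSH: append an unpushed operation $op$ of $L$ to $G$ as uncommitted (marking it pushed), if $G$ allows $op$ and $op\blacktriangleleft op'$ for all unpushed $op'$ earlier in $L$; - UNPUSH: remove a pushed uncommitted $op$ from $G$ (marking it unpushed), if the remaining shared log is allowed and $op'\blacktriangleleft op$ for all pushed $op'$ later in $L$; - PULL: append an operation $op$ of $G$ that is not in $L$ to $L$, marked pulled, if $L$ allows it and $op'\blacktriangleleft op$ for all own $op'$ in $L$; - UNPULL: drop a pulled operation from $L$,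 if the rest of $L$ is allowed; - CMT: if $\mathsf{fin}(c,\sigma)$, nothing in $L$ is unpushed, and everything pulled is committed in $G$: mark the pushed operations of $L$ as committed in $G$; the thread becomes $\{\mathtt{skip},\sigma,\emptyset\}$. This is the Push/Pull machine without the PUSH condition that all uncommitted operations of other transactions in $G$ move right of $op$. **Miner.** Every method call $m$ has a set of abstract locks, such that any two operations that do not commute have calls with a common lock. The miner runs the concurrent machine. A transaction begins an attempt, may acquire locks that nobody holds, executes (APP) an operation only while it holds all locks of its call, and releases its locks only when it commits, or when it aborts (to begin again later) with all its own operations undone. The miner emits a log $E$ of the events begin, lock $\ell$, op $o.m(\vec x)$ and commit. A miner trace, starting in the initial configuration and ending with all transactions committed, emits the happens-before relation $$\tau'\sqsubseteq\tau\iff(\tau',\mathsf{commit})<_E(\tau,\mathsf{commit})\ \wedge\ \exists\ell.\ (\tau',\mathsf{lock}\ \ell)\in E\wedge(\tau,\mathsf{lock}\ \ell)\in E .$$ **Validator.** The validator for $\sqsubseteq$ runs the concurrent machine without locks, but $\tau$ takes a step only when every $\tau'\sqsubseteq\tau$ has completed (its code is $\mathtt{skip}$). **Simulation.** Write $\pi\preceq\pi_A$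 for a miner or validator trace $\pi$ and an atomic trace $\pi_A$ if the configurations of $\pi$ can be mapped monotonically to those of $\pi_A$, first to first and last to last, so that for corresponding configurations: the committed part of $G$ is $\preceq$ the atomic log; committed transactions are $\mathtt{skip}$ in the atomic machine with the same local state; and all other transactions are in their initial code and local state. **Theorem.** Let $\pi_M$ be a miner trace that ends with all transactions committed and emits $\sqsubseteq$, and let $\pi_V$ be a trace of the validator for $\sqsubseteq$ that ends with all transactions committed. Then: 1. for all atomic traces $\pi_A,\pi'_A$ with $\pi_M\preceq\pi_A$ and $\pi_V\preceq\pi'_A$, we have $\pi_A\simeq\pi'_A$; 2. there is an atomic trace $\pi_A$ with $\pi_M\preceq\pi_A$; 3. there is an atomic trace $\pi'_A$ with $\pi_V\preceq\pi'_A$, provided that either the sequence of calls of a program does not depend on local states (the next call and remaining code are determined by the code alone), or in all local logs along $\pi_V$ pushed operations precede unpushed ones. -/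

import Mathlib

namespace PushPull

/-! ## Operations, programs and the shared object -/

/-- The observable part of an operation: a method call `o.m(x)` (object, method name and argument
values), together with the thread-local state before it and after it. The local state carries
primitive variables and returned values. -/
structure Act (Call State : Type*) where
  call : Call
  pre : State
  post : State

/-- An operation record: an `Act` with an operation identifier. -/
structure Op (Call State : Type*) extends Act Call State where
  id : ℕ

/-- The programming language and the shared object, in the abstract form of the Push/Pull model.

* `step c σ m c'` : in local state `σ`, the next method call reached by the code `c` is `m`, and the
  remaining code is `c'`;
* `fin c σ` : in local state `σ`, the code `c` reduces to `skip` without further work;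
* `allowed l` : the sequential specification of the shared object permits the log `l`.

Code is deterministic (`step_det`, `fin_not_step`), and so are the operations (`allowed_det`). -/
structure Model (Code Call State : Type*) where
  step : Code → State → Call → Code → Prop
  fin : Code → State → Prop
  allowed : List (Act Call State) → Prop
  step_det : ∀ {c σ m₁ c₁ m₂ c₂}, step c σ m₁ c₁ → step c σ m₂ c₂ → m₁ = m₂ ∧ c₁ = c₂
  fin_not_step : ∀ {c σ m c'}, fin c σ → ¬ step c σ m c'
  allowed_nil : allowed []
  allowed_prefix : ∀ {l a}, allowed (l ++ [a]) → allowed l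
  allowed_det : ∀ {l m σ σ₁ σ₂},
    allowed (l ++ [⟨m, σ, σ₁⟩]) → allowed (l ++ [⟨m, σ, σ₂⟩]) → σ₁ = σ₂

/-- Code of a thread: a running transaction `tx c`, or `skip` once the transaction has committed. -/
inductive TxCode (Code : Type*) where
  | tx (c : Code)
  | skip

section

variable {Code Call State Lock : Type*} {N : ℕ}

/-- The log relation `l₁ ≼ l₂` (observational inclusion): every continuation permitted after `l₁`
is permitted after `l₂`. This is the greatest relation such that `l₁ ≼ l₂` implies both
`allowed l₁ → allowed l₂` and `l₁ ++ [a] ≼ l₂ ++ [a]` for all `a`. -/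
def Model.LogLE (M : Model Code Call State) (l₁ l₂ : List (Act Call State)) : Prop :=
  ∀ s, M.allowed (l₁ ++ s) → M.allowed (l₂ ++ s)

/-- The mover relation `a ◂ b`: whenever `a` is directly followed by `b`, the two may be swapped. -/
def Model.Mover (M : Model Code Call State) (a b : Act Call State) : Prop :=
  ∀ l, M.LogLE (l ++ [a, b]) (l ++ [b, a])

/-- Two operations commute: after every log, both orders are observationally equal. -/
def Model.Commutes (M : Model Code Call State) (a b : Act Call State) : Prop :=
  M.Mover a b ∧ M.Mover b a

/-- The calls of a program do not depend on the local state (no data-dependent control flow or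
data-dependent arguments). -/
def Model.StaticCalls (M : Model Code Call State) : Prop :=
  ∀ c σ σ' m c', M.step c σ m c' → M.step c σ' m c'

/-- Boosting lock rule: operations that do not commute have an abstract lock in common. The set of
locks is attached to the method call, so it is known before the operation is executed. -/
def Model.BoostingLocks (M : Model Code Call State) (locks : Call → Set Lock) : Prop :=
  ∀ a b : Act Call State, ¬ M.Commutes a b → (locks a.call ∩ locks b.call).Nonempty

/-! ## Traces -/

/-- A finite trace of a labelled transition system, from the configuration `start` (the labels are
`Unit` for a system without labels). The values of
`state` after `len`, and of `label` from `len` on, are irrelevant. -/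
structure Trace {C E : Type*} (Step : C → E → C → Prop) (start : C) where
  len : ℕ
  state : ℕ → C
  label : ℕ → E
  state_zero : state 0 = start
  step : ∀ i < len, Step (state i) (label i) (state (i + 1))

/-- The last configuration of a trace. -/
def Trace.final {C E : Type*} {Step : C → E → C → Prop} {start : C} (π : Trace Step start) : C :=
  π.state π.len

/-! ## The atomic machine -/

/-- Configuration of the atomic machine: code and local state of each transaction, and a log. -/
structure AtomicConfig (Code Call State : Type*) (N : ℕ) where
  thread : Fin N → TxCode Code × State
  log : List (Op Call State)

/-- `BigStep M c σ l σ' l'`: run without interruption from local state `σ` and shared log `l`, the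
code `c` terminates with local state `σ'` and shared log `l'`. -/
inductive BigStep (M : Model Code Call State) :
    Code → State → List (Op Call State) → State → List (Op Call State) → Prop
  | fin {c σ l} : M.fin c σ → BigStep M c σ l σ l
  | step {c σ l m c' σ' id σ'' l''} :
      M.step c σ m c' →
      M.allowed (l.map Op.toAct ++ [⟨m, σ, σ'⟩]) →
      (∀ o ∈ l, o.id ≠ id) →
      BigStep M c' σ' (l ++ [⟨⟨m, σ, σ'⟩, id⟩]) σ'' l'' →
      BigStep M c σ l σ'' l''

/-- A step of the atomic machine selects a transaction and runs it to completion. -/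
inductive AtomicStep (M : Model Code Call State) :
    AtomicConfig Code Call State N → AtomicConfig Code Call State N → Prop
  | run {A : AtomicConfig Code Call State N} {τ c σ σ' l'} :
      A.thread τ = (TxCode.tx c, σ) →
      BigStep M c σ A.log σ' l' →
      AtomicStep M A ⟨Function.update A.thread τ (TxCode.skip, σ'), l'⟩

/-- Initial configuration of the atomic machine. -/
def AtomicConfig.start (init : Fin N → Code × State) : AtomicConfig Code Call State N where
  thread τ := (TxCode.tx (init τ).1, (init τ).2)
  log := []

/-- Serial traces, from the initial configuration. -/
abbrev AtomicTrace (M : Model Code Call State) (init : Fin N → Code × State) :=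
  Trace (fun (A : AtomicConfig Code Call State N) (_ : Unit) A' => AtomicStep M A A')
    (AtomicConfig.start init)

/-- A serial trace is complete when each transaction has been reduced to `skip`. -/
def AtomicTrace.Complete {M : Model Code Call State} {init : Fin N → Code × State}
    (π : AtomicTrace M init) : Prop :=
  ∀ τ, (π.final.thread τ).1 = TxCode.skip

/-- Equivalence `π ≃ π'` of complete serial traces (from the same initial configuration): the
final shared logs are observationally equal, and the final local states are equal. -/
structure AtomicTrace.Equiv {M : Model Code Call State} {init : Fin N → Code × State}
    (π π' : AtomicTrace M init) : Prop where
  complete_left : π.Complete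
  complete_right : π'.Complete
  log_le : M.LogLE (π.final.log.map Op.toAct) (π'.final.log.map Op.toAct)
  log_ge : M.LogLE (π'.final.log.map Op.toAct) (π.final.log.map Op.toAct)
  local_eq : ∀ τ, (π.final.thread τ).2 = (π'.final.thread τ).2

/-! ## The Push/Pull machine -/

/-- Status of an operation in a local log: applied but not pushed to the shared log, pushed (in
both cases with the code before the operation, for rolling back), or pulled from the shared log. -/
inductive LocalFlag (Code : Type*) where
  | unpushed (c : Code)
  | pushed (c : Code)
  | pulled

/-- Entry of a local log. -/
structure LocalEntry (Code Call State : Type*) where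
  op : Op Call State
  flag : LocalFlag Code

def LocalEntry.IsUnpushed (e : LocalEntry Code Call State) : Prop :=
  ∃ c, e.flag = LocalFlag.unpushed c

def LocalEntry.IsPushed (e : LocalEntry Code Call State) : Prop :=
  ∃ c, e.flag = LocalFlag.pushed c

def LocalEntry.IsPulled (e : LocalEntry Code Call State) : Prop :=
  e.flag = LocalFlag.pulled

/-- Entry of the shared log: an operation, and whether its transaction has committed. -/
structure SharedEntry (Call State : Type*) where
  op : Op Call State
  committed : Bool

/-- A thread `{c, σ, L}`: code, local state and local log. -/
structure Thread (Code Call State : Type*) where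
  code : TxCode Code
  loc : State
  log : List (LocalEntry Code Call State)

/-- Configuration `T, G`: the threads and the shared log. -/
structure Config (Code Call State : Type*) (N : ℕ) where
  thread : Fin N → Thread Code Call State
  shared : List (SharedEntry Call State)

/-- Initial configuration: all logs are empty. -/
def Config.start (init : Fin N → Code × State) : Config Code Call State N where
  thread τ := ⟨TxCode.tx (init τ).1, (init τ).2, []⟩
  shared := []

/-- The operations of a local log, without identifiers. -/
def localActs (L : List (LocalEntry Code Call State)) : List (Act Call State) :=
  L.map fun e => e.op.toAct

/-- The operations of a shared log, without identifiers. -/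
def sharedActs (G : List (SharedEntry Call State)) : List (Act Call State) :=
  G.map fun g => g.op.toAct

/-- The committed operations of a shared log. -/
def committedActs (G : List (SharedEntry Call State)) : List (Act Call State) :=
  sharedActs (G.filter fun g => g.committed)

/-- The identifier occurs neither in a local log nor in the shared log. -/
def Config.Fresh (X : Config Code Call State N) (id : ℕ) : Prop :=
  (∀ τ, ∀ e ∈ (X.thread τ).log, e.op.id ≠ id) ∧ ∀ g ∈ X.shared, g.op.id ≠ id

/-- Replace the thread `τ`. -/
def Config.setThread (X : Config Code Call State N) (τ : Fin N) (t : Thread Code Call State) :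
    Config Code Call State N :=
  ⟨Function.update X.thread τ t, X.shared⟩

open Classical in
/-- Mark as committed the operations of `G` that were pushed from the local log `L`. -/
noncomputable def commitShared (L : List (LocalEntry Code Call State))
    (G : List (SharedEntry Call State)) : List (SharedEntry Call State) :=
  G.map fun g => if ∃ e ∈ L, e.IsPushed ∧ e.op.id = g.op.id then ⟨g.op, true⟩ else g

/-- Names of the rules of the machine. -/
inductive Rule (Call : Type*) where
  | app (m : Call)
  | unapp
  | push
  | unpush
  | pull
  | unpull
  | cmt

/-- The rules that neither execute an operation nor commit. -/
def Rule.Silent : Rule Call → Prop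
  | .app _ => False
  | .cmt => False
  | _ => True

/-- The Push/Pull machine without the side condition of PUSH on the operations of concurrent
transactions (that all uncommitted operations of other transactions in the shared log move to the
right of the operation that is pushed). `CoreStep M X τ r X'`: by the rule `r`, the transaction `τ`
takes a step from `X` to `X'`. -/
inductive CoreStep (M : Model Code Call State) :
    Config Code Call State N → Fin N → Rule Call → Config Code Call State N → Prop
  /-- Apply an operation that is permitted by the local view. -/
  | app {X : Config Code Call State N} {τ c σ L m c' σ' id} :
      X.thread τ = ⟨.tx c, σ, L⟩ →
      M.step c σ m c' →
      M.allowed (localActs L ++ [⟨m, σ, σ'⟩]) →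
      X.Fresh id →
      CoreStep M X τ (.app m)
        (X.setThread τ ⟨.tx c', σ', L ++ [⟨⟨⟨m, σ, σ'⟩, id⟩, .unpushed c⟩]⟩)
  /-- Undo the last operation of the local log, if it is not pushed. -/
  | unapp {X : Config Code Call State N} {τ c c' σ L o} :
      X.thread τ = ⟨.tx c', σ, L ++ [⟨o, .unpushed c⟩]⟩ →
      CoreStep M X τ .unapp (X.setThread τ ⟨.tx c, o.pre, L⟩)
  /-- Share an operation: it moves left of the earlier operations of the transaction that are not
  pushed, and the shared log permits it. -/
  | push {X : Config Code Call State N} {τ c σ L₁ L₂ o c₀} :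
      X.thread τ = ⟨.tx c, σ, L₁ ++ ⟨o, .unpushed c₀⟩ :: L₂⟩ →
      (∀ e ∈ L₁, e.IsUnpushed → M.Mover o.toAct e.op.toAct) →
      M.allowed (sharedActs X.shared ++ [o.toAct]) →
      CoreStep M X τ .push
        ⟨Function.update X.thread τ ⟨.tx c, σ, L₁ ++ ⟨o, .pushed c₀⟩ :: L₂⟩,
          X.shared ++ [⟨o, false⟩]⟩
  /-- Withdraw an operation from the shared log: the later operations of the transaction that stay
  pushed move left of it, as in PUSH, and the remaining shared log is permitted. -/
  | unpush {X : Config Code Call State N} {τ c σ L₁ L₂ o c₀ G₁ G₂} :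
      X.thread τ = ⟨.tx c, σ, L₁ ++ ⟨o, .pushed c₀⟩ :: L₂⟩ →
      X.shared = G₁ ++ ⟨o, false⟩ :: G₂ →
      (∀ e ∈ L₂, e.IsPushed → M.Mover e.op.toAct o.toAct) →
      M.allowed (sharedActs (G₁ ++ G₂)) →
      CoreStep M X τ .unpush
        ⟨Function.update X.thread τ ⟨.tx c, σ, L₁ ++ ⟨o, .unpushed c₀⟩ :: L₂⟩, G₁ ++ G₂⟩
  /-- View an operation of the shared log: it is new, the local view permits it, and the own
  operations of the transaction move right of it. -/
  | pull {X : Config Code Call State N} {τ c σ L g} :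
      X.thread τ = ⟨.tx c, σ, L⟩ →
      g ∈ X.shared →
      (∀ e ∈ L, e.op.id ≠ g.op.id) →
      M.allowed (localActs L ++ [g.op.toAct]) →
      (∀ e ∈ L, ¬ e.IsPulled → M.Mover e.op.toAct g.op.toAct) →
      CoreStep M X τ .pull (X.setThread τ ⟨.tx c, σ, L ++ [⟨g.op, .pulled⟩]⟩)
  /-- Discard a pulled operation, if the local view does not depend on it. -/
  | unpull {X : Config Code Call State N} {τ c σ L₁ L₂ o} :
      X.thread τ = ⟨.tx c, σ, L₁ ++ ⟨o, .pulled⟩ :: L₂⟩ →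
      M.allowed (localActs (L₁ ++ L₂)) →
      CoreStep M X τ .unpull (X.setThread τ ⟨.tx c, σ, L₁ ++ L₂⟩)
  /-- Commit: the code is finished, all own operations are pushed, and all pulled operations are
  committed. -/
  | cmt {X : Config Code Call State N} {τ c σ L} :
      X.thread τ = ⟨.tx c, σ, L⟩ →
      M.fin c σ →
      (∀ e ∈ L, ¬ e.IsUnpushed) →
      (∀ e ∈ L, e.IsPulled → ∃ g ∈ X.shared, g.op = e.op ∧ g.committed = true) →
      CoreStep M X τ .cmt
        ⟨Function.update X.thread τ ⟨.skip, σ, []⟩, commitShared L X.shared⟩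

/-- All transactions have committed. -/
def Config.Complete (X : Config Code Call State N) : Prop :=
  ∀ τ, (X.thread τ).code = TxCode.skip

/-- In every local log, the pushed operations precede the operations that are not pushed. -/
def Config.PushedInOrder (X : Config Code Call State N) : Prop :=
  ∀ τ, (X.thread τ).log.Pairwise fun e e' => e.IsUnpushed → ¬ e'.IsPushed

/-! ## Simulation by the atomic machine -/

/-- The Push/Pull configuration `X` is simulated by the atomic configuration `A`: the committed
part of the shared log of `X` is observationally included in the log of `A`, a committed
transaction is finished in `A` with the same local state, and any other one is not started. -/
def SimRel (M : Model Code Call State) (init : Fin N → Code × State)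
    (X : Config Code Call State N) (A : AtomicConfig Code Call State N) : Prop :=
  M.LogLE (committedActs X.shared) (A.log.map Op.toAct) ∧
  ∀ τ, A.thread τ =
    match (X.thread τ).code with
    | .tx _ => (TxCode.tx (init τ).1, (init τ).2)
    | .skip => (TxCode.skip, (X.thread τ).loc)

/-- `π ≼ πA`, the log relation lifted to traces: along the whole trace `π`, its configurations are
simulated by those of the serial trace `πA`, in the same order. The function `view` extracts the
Push/Pull configuration. -/
def Trace.SimulatedBy {C E : Type*} {Step : C → E → C → Prop} {start : C} (π : Trace Step start)
    (view : C → Config Code Call State N) {M : Model Code Call State}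
    {init : Fin N → Code × State} (πA : AtomicTrace M init) : Prop :=
  ∃ f : ℕ → ℕ, f 0 = 0 ∧ f π.len = πA.len ∧ (∀ i < π.len, f i ≤ f (i + 1)) ∧
    ∀ i ≤ π.len, SimRel M init (view (π.state i)) (πA.state (f i))

/-! ## Miners -/

/-- Kinds of events in the event log of a miner. -/
inductive EventKind (Call Lock : Type*) where
  | begin
  | lock (ℓ : Lock)
  | op (m : Call)
  | commit

/-- An event `(τ, kind)`. -/
abbrev Event (Call Lock : Type*) (N : ℕ) := Fin N × EventKind Call Lock

/-- Configuration of the miner: a Push/Pull configuration, the abstract locks held by each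
transaction, and whether a speculative attempt of the transaction is under way. -/
structure MinerConfig (Code Call State Lock : Type*) (N : ℕ) where
  cfg : Config Code Call State N
  held : Fin N → Set Lock
  active : Fin N → Bool

/-- Initial configuration of the miner. -/
def MinerConfig.start (init : Fin N → Code × State) : MinerConfig Code Call State Lock N :=
  ⟨Config.start init, fun _ => ∅, fun _ => false⟩

/-- The speculative miner. Abstract locks are mutually exclusive; a transaction executes an
operation only when it holds the locks of the operation, and keeps its locks until it commits, or
until it aborts with all of its operations undone. Nothing is checked about the operations of
concurrent transactions. The label is the event that is emitted, if any. -/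
inductive MinerStep (M : Model Code Call State) (locks : Call → Set Lock) :
    MinerConfig Code Call State Lock N → Option (Event Call Lock N) →
      MinerConfig Code Call State Lock N → Prop
  | begin {X : MinerConfig Code Call State Lock N} {τ c} :
      X.active τ = false →
      (X.cfg.thread τ).code = .tx c →
      MinerStep M locks X (some (τ, .begin)) ⟨X.cfg, X.held, Function.update X.active τ true⟩
  | lock {X : MinerConfig Code Call State Lock N} {τ ℓ} :
      X.active τ = true →
      (∀ τ', ℓ ∉ X.held τ') →
      MinerStep M locks X (some (τ, .lock ℓ))
        ⟨X.cfg, Function.update X.held τ (insert ℓ (X.held τ)), X.active⟩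
  | op {X : MinerConfig Code Call State Lock N} {τ m Y} :
      X.active τ = true →
      locks m ⊆ X.held τ →
      CoreStep M X.cfg τ (.app m) Y →
      MinerStep M locks X (some (τ, .op m)) ⟨Y, X.held, X.active⟩
  | silent {X : MinerConfig Code Call State Lock N} {τ r Y} :
      X.active τ = true →
      r.Silent →
      CoreStep M X.cfg τ r Y →
      MinerStep M locks X none ⟨Y, X.held, X.active⟩
  | commit {X : MinerConfig Code Call State Lock N} {τ Y} :
      X.active τ = true →
      CoreStep M X.cfg τ .cmt Y →
      MinerStep M locks X (some (τ, .commit))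
        ⟨Y, Function.update X.held τ ∅, Function.update X.active τ false⟩
  | abort {X : MinerConfig Code Call State Lock N} {τ} :
      X.active τ = true →
      (∀ e ∈ (X.cfg.thread τ).log, e.IsPulled) →
      MinerStep M locks X none
        ⟨X.cfg, Function.update X.held τ ∅, Function.update X.active τ false⟩

/-- Traces of the miner. -/
abbrev MinerTrace (M : Model Code Call State) (locks : Call → Set Lock)
    (init : Fin N → Code × State) :=
  Trace (MinerStep (N := N) M locks) (MinerConfig.start init)

/-- The event log emitted by a miner trace. -/
def MinerTrace.eventLog {M : Model Code Call State} {locks : Call → Set Lock}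
    {init : Fin N → Code × State} (π : MinerTrace M locks init) : List (Event Call Lock N) :=
  (List.range π.len).filterMap π.label

/-- The event `e` occurs before the event `e'` in the event log `E`. -/
def Precedes (E : List (Event Call Lock N)) (e e' : Event Call Lock N) : Prop :=
  ∃ i j : ℕ, i < j ∧ E[i]? = some e ∧ E[j]? = some e'

/-- The happens-before relation `τ' ⊑ τ` constructed from an event log: `τ'` commits before `τ`,
and both acquire a common lock. -/
def HappensBefore (E : List (Event Call Lock N)) (τ' τ : Fin N) : Prop :=
  Precedes E (τ', .commit) (τ, .commit) ∧ ∃ ℓ, (τ', .lock ℓ) ∈ E ∧ (τ, .lock ℓ) ∈ E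

/-! ## Validators -/

/-- The validator for the relation `hb` (fork-join execution): no locks, no conflict checks, and a
transaction takes a step only if all its predecessors have completed. -/
inductive ValidatorStep (M : Model Code Call State) (hb : Fin N → Fin N → Prop) :
    Config Code Call State N → Config Code Call State N → Prop
  | step {X : Config Code Call State N} {τ r Y} :
      (∀ τ', hb τ' τ → (X.thread τ').code = .skip) →
      CoreStep M X τ r Y →
      ValidatorStep M hb X Y

/-- Traces of the validator. -/
abbrev ValidatorTrace (M : Model Code Call State) (hb : Fin N → Fin N → Prop)
    (init : Fin N → Code × State) :=
  Trace (fun (X : Config Code Call State N) (_ : Unit) X' => ValidatorStep M hb X X')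
    (Config.start init)

end

end PushPull

open PushPull

namespace PushPull

section

variable {Code Call State Lock : Type*} {N : ℕ}

/-! ## Order of two elements in a list -/

/-! The serial order is the order of commits. When a transaction commits, its operations lie in the
shared log in the order of their pushes, interleaved with those of others. They have to be sorted
into program order and moved to the end of the committed part. The side conditions of PUSH and
UNPUSH pay for the sorting. Moving right past other transactions needs that operations of different
transactions which are pushed at the same time are movers (`PairSafe`); this stands in for the
missing condition of PUSH. `OrderInv` records the mover facts at the time of a push, so that they
outlive the commit of the other transaction, after which `PairSafe` says nothing about it.
`OrderInv.commit_logLE` and `OrderInv.allowed_committed` then turn each commit into one atomic step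
(`SimRel.step_cmt`).

For the miner, `PairSafe` follows from mutual exclusion of the locks. Its commit order yields a
canonical serial execution (`Canon`) in which transactions unrelated by happens-before have
commuting operations. Commutation is known for all operations with the calls concerned, whatever
their states, because locks are attached to calls.

Uniqueness of the outcome: an interleaving that respects happens-before and follows the canonical
runs (`Canon.Good`) can be completed to a log equivalent to the canonical one, since a remaining
operation that has to be passed belongs to an unrelated transaction (`Good.exists_rest`). Hence the
next canonical operation is allowed after such a log, and determinism of operations and of code
forces every atomic execution that respects happens-before to follow the canonical runs
(`Canon.atomic_final`). Atomic traces that simulate the miner or the validator do respect it: each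
of their configurations is matched by a concurrent one (`Trace.SimulatedBy.exists_simRel`), whose
finished transactions are closed under predecessors.

For the existence of a simulation of the validator, `PairSafe` is again the crux. Two transactions
with pushed operations are both running, hence unrelated; but commutation is known only for calls of
the canonical runs. The two provisos ensure that only such calls are pushed: static calls do so
directly, and pushes in program order do so because the shared log then follows the canonical runs
(`Follows`), by the same determinism argument. -/

theorem pair_sublist_cons {α : Type*} {x y z : α} {l : List α} :
    [x, y].Sublist (z :: l) ↔ (x = z ∧ y ∈ l) ∨ [x, y].Sublist l := by
  rw [List.sublist_cons_iff]
  constructor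
  · rintro (h | ⟨r, hr, h⟩)
    · exact Or.inr h
    · simp only [List.cons.injEq] at hr
      obtain ⟨rfl, rfl⟩ := hr
      exact Or.inl ⟨rfl, List.singleton_sublist.1 h⟩
  · rintro (⟨rfl, h⟩ | h)
    · exact Or.inr ⟨[y], rfl, List.singleton_sublist.2 h⟩
    · exact Or.inl h

theorem pair_sublist_append {α : Type*} {x y : α} {a b : List α} :
    [x, y].Sublist (a ++ b) ↔ [x, y].Sublist a ∨ [x, y].Sublist b ∨ (x ∈ a ∧ y ∈ b) := by
  induction a with
  | nil => simp
  | cons z a ih =>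
    simp only [List.cons_append, pair_sublist_cons, ih, List.mem_append, List.mem_cons]
    tauto

theorem pair_sublist_asymm {α : Type*} {x y : α} {l : List α} (hl : l.Nodup)
    (h : [x, y].Sublist l) : ¬ [y, x].Sublist l := by
  induction l with
  | nil => simp at h
  | cons z l ih =>
    rw [List.nodup_cons] at hl
    rw [pair_sublist_cons] at h ⊢
    rintro (⟨rfl, h'⟩ | h')
    · rcases h with ⟨rfl, h⟩ | h
      · exact hl.1 h
      · exact hl.1 (h.subset (by simp))
    · rcases h with ⟨rfl, h⟩ | h
      · exact hl.1 (h'.subset (by simp))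
      · exact ih hl.2 h h'

theorem pair_sublist_mem {α : Type*} {x y : α} {l : List α} (h : [x, y].Sublist l) :
    x ∈ l ∧ y ∈ l := ⟨h.subset (by simp), h.subset (by simp)⟩

/-! ## The log relation -/

namespace Model

variable {M : Model Code Call State}

theorem LogLE.refl (l : List (Act Call State)) : M.LogLE l l := fun _ h => h

theorem LogLE.trans {l₁ l₂ l₃ : List (Act Call State)} (h : M.LogLE l₁ l₂) (h' : M.LogLE l₂ l₃) :
    M.LogLE l₁ l₃ := fun s hs => h' s (h s hs)

theorem LogLE.append_right {l₁ l₂ : List (Act Call State)} (h : M.LogLE l₁ l₂)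
    (t : List (Act Call State)) : M.LogLE (l₁ ++ t) (l₂ ++ t) := fun s hs => by
  rw [List.append_assoc] at hs ⊢
  exact h _ hs

theorem LogLE.allowed {l₁ l₂ : List (Act Call State)} (h : M.LogLE l₁ l₂) (ha : M.allowed l₁) :
    M.allowed l₂ := by simpa using h [] (by simpa using ha)

theorem allowed_of_append {l t : List (Act Call State)} (h : M.allowed (l ++ t)) :
    M.allowed l := by
  induction t using List.reverseRecOn with
  | nil => simpa using h
  | append_singleton t a ih =>
    rw [← List.append_assoc] at h
    exact ih (M.allowed_prefix h)

/-- The operation `a` passes the elements of `l` from the last to the first, one adjacent swap each;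
the prefix `p` absorbs those not yet passed. -/
theorem logLE_move_front {a : Act Call State} {l : List (Act Call State)}
    (h : ∀ x ∈ l, M.Mover x a) (p s : List (Act Call State)) :
    M.LogLE (p ++ (l ++ a :: s)) (p ++ a :: (l ++ s)) := by
  induction l generalizing p with
  | nil => exact LogLE.refl _
  | cons x l ih =>
    have h₁ := ih (fun y hy => h y (List.mem_cons_of_mem _ hy)) (p ++ [x])
    have h₂ := (h x List.mem_cons_self p).append_right (l ++ s)
    simp only [List.append_assoc, List.cons_append, List.nil_append] at h₁ h₂ ⊢
    exact h₁.trans h₂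

theorem logLE_move_back {a : Act Call State} {l : List (Act Call State)}
    (h : ∀ x ∈ l, M.Mover a x) (p s : List (Act Call State)) :
    M.LogLE (p ++ a :: (l ++ s)) (p ++ (l ++ a :: s)) := by
  induction l generalizing p with
  | nil => exact LogLE.refl _
  | cons x l ih =>
    have h₁ := ih (fun y hy => h y (List.mem_cons_of_mem _ hy)) (p ++ [x])
    have h₂ := (h x List.mem_cons_self p).append_right (l ++ s)
    simp only [List.append_assoc, List.cons_append, List.nil_append] at h₁ h₂ ⊢
    exact h₂.trans h₁

/-- A log may be reordered if each pair of operations whose order changes are movers. -/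
theorem logLE_of_perm {α : Type*} (f : α → Act Call State) {l t : List α} (hp : l.Perm t)
    (hn : t.Nodup)
    (h : ∀ x y, [x, y].Sublist l → [y, x].Sublist t → M.Mover (f x) (f y))
    (p : List (Act Call State)) : M.LogLE (p ++ l.map f) (p ++ t.map f) := by
  induction t generalizing l p with
  | nil => rw [hp.eq_nil]; exact LogLE.refl _
  | cons y t ih =>
    -- Selection sort: `y` comes first in the target, so each element of `l₁` forms with `y` a pair
    -- whose order changes. Moving `y` to the front uses exactly those pairs.
    obtain ⟨l₁, l₂, rfl⟩ := List.append_of_mem (hp.mem_iff.2 List.mem_cons_self)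
    have hp' : (l₁ ++ l₂).Perm t := (List.perm_middle.symm.trans hp).cons_inv
    rw [List.nodup_cons] at hn
    have h₁ : M.LogLE (p ++ (l₁.map f ++ f y :: l₂.map f)) (p ++ f y :: (l₁.map f ++ l₂.map f)) := by
      refine logLE_move_front (fun z hz => ?_) _ _
      obtain ⟨x, hx, rfl⟩ := List.mem_map.1 hz
      refine h x y (pair_sublist_append.2 (Or.inr (Or.inr ⟨hx, List.mem_cons_self⟩)))
        (pair_sublist_cons.2 (Or.inl ⟨rfl, hp'.mem_iff.1 (List.mem_append_left _ hx)⟩))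
    have h₂ := ih hp' hn.2 (fun x z hxz hzx => h x z
      (hxz.trans (List.Sublist.append_left (List.sublist_cons_self _ _) _))
      (hzx.trans (List.sublist_cons_self _ _))) (p ++ [f y])
    simp only [List.map_append, List.map_cons, List.append_assoc, List.cons_append,
      List.nil_append] at h₁ h₂ ⊢
    exact h₁.trans h₂

/-- A log may be partitioned if the operations put last move right of those put first. -/
theorem logLE_filter {α : Type*} (f : α → Act Call State) (q : α → Bool) {l : List α}
    (h : ∀ x y, [x, y].Sublist l → q x = false → q y = true → M.Mover (f x) (f y)) :
    M.LogLE (l.map f) ((l.filter q).map f ++ (l.filter (fun x => !q x)).map f) := by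
  suffices H : ∀ p, M.LogLE (p ++ l.map f)
      (p ++ ((l.filter q).map f ++ (l.filter (fun x => !q x)).map f)) by simpa using H []
  induction l with
  | nil => exact fun p => LogLE.refl _
  | cons x l ih =>
    intro p
    have h₁ := ih (fun y z hyz => h y z (pair_sublist_cons.2 (Or.inr hyz))) (p ++ [f x])
    simp only [List.append_assoc, List.cons_append, List.nil_append] at h₁
    cases hq : q x with
    | true => simpa [hq] using h₁
    | false =>
      simp only [List.map_cons, List.filter_cons, hq, Bool.not_false, if_true, Bool.false_eq_true,
        if_false]
      refine h₁.trans (logLE_move_back (fun z hz => ?_) _ _)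
      obtain ⟨y, hy, rfl⟩ := List.mem_map.1 hz
      rw [List.mem_filter] at hy
      exact h x y (pair_sublist_cons.2 (Or.inl ⟨rfl, hy.1⟩)) hq hy.2

/-! ## Runs of a program -/

/-- `M.Run c σ as c' σ'`: the code `c` in local state `σ` executes the operations `as` and reaches
the code `c'` in local state `σ'`. -/
def Run (M : Model Code Call State) : Code → State → List (Act Call State) → Code → State → Prop
  | c, σ, [], c', σ' => c = c' ∧ σ = σ'
  | c, σ, a :: as, c', σ' => a.pre = σ ∧ ∃ c₁, M.step c σ a.call c₁ ∧ M.Run c₁ a.post as c' σ'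

/-- As `Run`, where each operation is annotated with the code that precedes it. -/
def Exec (M : Model Code Call State) :
    Code → State → List (Code × Op Call State) → Code → State → Prop
  | c, σ, [], c', σ' => c = c' ∧ σ = σ'
  | c, σ, p :: ps, c', σ' =>
    p.1 = c ∧ p.2.pre = σ ∧ ∃ c₁, M.step c σ p.2.call c₁ ∧ M.Exec c₁ p.2.post ps c' σ'

theorem exec_append {c c' : Code} {σ σ' : State} {ps qs : List (Code × Op Call State)} :
    M.Exec c σ (ps ++ qs) c' σ' ↔ ∃ c₁ σ₁, M.Exec c σ ps c₁ σ₁ ∧ M.Exec c₁ σ₁ qs c' σ' := by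
  induction ps generalizing c σ with
  | nil => simp [Exec]
  | cons p ps ih =>
    simp only [List.cons_append, Exec, ih]
    constructor
    · rintro ⟨h₁, h₂, c₁, h₃, c₂, σ₂, h₄, h₅⟩
      exact ⟨c₂, σ₂, ⟨h₁, h₂, c₁, h₃, h₄⟩, h₅⟩
    · rintro ⟨c₂, σ₂, ⟨h₁, h₂, c₁, h₃, h₄⟩, h₅⟩
      exact ⟨h₁, h₂, c₁, h₃, c₂, σ₂, h₄, h₅⟩

theorem Exec.run {c c' : Code} {σ σ' : State} {ps : List (Code × Op Call State)}
    (h : M.Exec c σ ps c' σ') : M.Run c σ (ps.map fun p => p.2.toAct) c' σ' := by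
  induction ps generalizing c σ with
  | nil => exact h
  | cons p ps ih =>
    obtain ⟨_, h₂, c₁, h₃, h₄⟩ := h
    exact ⟨h₂, c₁, h₃, ih h₄⟩

/-- A run is determined by its operations. -/
theorem Run.append_right {c c₁ c₂ : Code} {σ σ₁ σ₂ : State} {as bs : List (Act Call State)}
    (h : M.Run c σ as c₁ σ₁) (h' : M.Run c σ (as ++ bs) c₂ σ₂) : M.Run c₁ σ₁ bs c₂ σ₂ := by
  induction as generalizing c σ with
  | nil => obtain ⟨rfl, rfl⟩ := h; exact h'
  | cons a as ih =>
    obtain ⟨_, d, h₃, h₄⟩ := h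
    obtain ⟨_, d', h₃', h₄'⟩ := h'
    obtain rfl := (M.step_det h₃ h₃').2
    exact ih h₄ h₄'

theorem Run.eq_nil_of_fin {c c' : Code} {σ σ' : State} {as : List (Act Call State)}
    (h : M.Run c σ as c' σ') (hf : M.fin c σ) : as = [] := by
  cases as with
  | nil => rfl
  | cons a as => obtain ⟨_, d, h₃, _⟩ := h; exact absurd h₃ (M.fin_not_step hf)

/-- If the calls do not depend on the local state, the calls of a run form an initial segment of
the calls of a finished run. -/
theorem StaticCalls.calls_prefix (hs : M.StaticCalls) {c c₁ c₂ : Code} {σ σ' σ₁ σ₂ : State}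
    {as bs : List (Act Call State)} (h : M.Run c σ as c₁ σ₁) (h' : M.Run c σ' bs c₂ σ₂)
    (hf : M.fin c₂ σ₂) : as.map Act.call <+: bs.map Act.call := by
  induction as generalizing c σ σ' bs with
  | nil => simp
  | cons a as ih =>
    obtain ⟨_, d, h₃, h₄⟩ := h
    cases bs with
    | nil =>
      obtain ⟨rfl, rfl⟩ := h'
      -- The other run is finished at this code; a call there in some state would, being static,
      -- also be reached in its final state.
      exact absurd (hs _ _ _ _ _ h₃) (M.fin_not_step hf)
    | cons b bs =>
      obtain ⟨_, d', h₃', h₄'⟩ := h'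
      obtain ⟨he, rfl⟩ := M.step_det (hs _ _ _ _ _ h₃) h₃'
      simpa [he] using ih h₄ h₄'

end Model

/-! ## Own operations of a local log -/

/-- The own operations of a local log, with the code before each. -/
def ownOps (L : List (LocalEntry Code Call State)) : List (Code × Op Call State) :=
  L.filterMap fun e => match e.flag with
    | .unpushed c => some (c, e.op)
    | .pushed c => some (c, e.op)
    | .pulled => none

/-- The pushed operations of a local log. -/
def pushedOps (L : List (LocalEntry Code Call State)) : List (Op Call State) :=
  L.filterMap fun e => match e.flag with
    | .pushed _ => some e.op
    | _ => none

/-- The own operations of a local log, without identifiers. -/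
def ownActs (L : List (LocalEntry Code Call State)) : List (Act Call State) :=
  (ownOps L).map fun p => p.2.toAct

section Own

variable {L L' : List (LocalEntry Code Call State)} {o : Op Call State} {c : Code}

@[simp] theorem ownOps_nil : ownOps ([] : List (LocalEntry Code Call State)) = [] := rfl

@[simp] theorem ownOps_append : ownOps (L ++ L') = ownOps L ++ ownOps L' := by simp [ownOps]

@[simp] theorem ownOps_cons_unpushed : ownOps (⟨o, .unpushed c⟩ :: L) = (c, o) :: ownOps L := rfl

@[simp] theorem ownOps_cons_pushed : ownOps (⟨o, .pushed c⟩ :: L) = (c, o) :: ownOps L := rfl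

@[simp] theorem ownOps_cons_pulled : ownOps (⟨o, .pulled⟩ :: L) = ownOps L := rfl

@[simp] theorem pushedOps_nil : pushedOps ([] : List (LocalEntry Code Call State)) = [] := rfl

@[simp] theorem pushedOps_append : pushedOps (L ++ L') = pushedOps L ++ pushedOps L' := by
  simp [pushedOps]

@[simp] theorem pushedOps_cons_unpushed : pushedOps (⟨o, .unpushed c⟩ :: L) = pushedOps L := rfl

@[simp] theorem pushedOps_cons_pushed : pushedOps (⟨o, .pushed c⟩ :: L) = o :: pushedOps L := rfl

@[simp] theorem pushedOps_cons_pulled : pushedOps (⟨o, .pulled⟩ :: L) = pushedOps L := rfl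

theorem mem_pushedOps : o ∈ pushedOps L ↔ ∃ e ∈ L, e.IsPushed ∧ e.op = o := by
  simp only [pushedOps, List.mem_filterMap]
  constructor
  · rintro ⟨⟨o', f⟩, he, h⟩
    cases f <;> simp only [reduceCtorEq, Option.some.injEq] at h
    exact ⟨_, he, ⟨_, rfl⟩, h⟩
  · rintro ⟨⟨o', f⟩, he, ⟨c, hc⟩, h⟩
    simp only at hc
    subst hc
    exact ⟨_, he, by simpa using h⟩

theorem mem_ownOps_of_not_isPulled {e : LocalEntry Code Call State} (he : e ∈ L)
    (h : ¬ e.IsPulled) : ∃ c, (c, e.op) ∈ ownOps L := by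
  obtain ⟨o', f⟩ := e
  cases f with
  | unpushed c => exact ⟨c, List.mem_filterMap.2 ⟨_, he, rfl⟩⟩
  | pushed c => exact ⟨c, List.mem_filterMap.2 ⟨_, he, rfl⟩⟩
  | pulled => exact absurd rfl h

theorem mem_ownOps_of_mem_pushedOps (h : o ∈ pushedOps L) : ∃ c, (c, o) ∈ ownOps L := by
  obtain ⟨e, he, ⟨c, hc⟩, rfl⟩ := mem_pushedOps.1 h
  exact mem_ownOps_of_not_isPulled he (by simp [LocalEntry.IsPulled, hc])

theorem ownOps_eq_nil_of_pulled (h : ∀ e ∈ L, e.IsPulled) : ownOps L = [] := by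
  simp only [ownOps, List.filterMap_eq_nil_iff]
  intro e he
  have := h e he
  simp only [LocalEntry.IsPulled] at this
  rw [this]

theorem pushedOps_sublist : (pushedOps L).Sublist ((ownOps L).map Prod.snd) := by
  induction L with
  | nil => simp
  | cons e L ih =>
    obtain ⟨o', f⟩ := e
    cases f with
    | unpushed c => simpa using ih.trans (List.sublist_cons_self _ _)
    | pushed c => simpa using ih
    | pulled => simpa using ih

theorem map_ownOps_eq_pushedOps (h : ∀ e ∈ L, ¬ e.IsUnpushed) :
    (ownOps L).map Prod.snd = pushedOps L := by
  induction L with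
  | nil => simp
  | cons e L ih =>
    obtain ⟨o', f⟩ := e
    have := ih fun e he => h e (List.mem_cons_of_mem _ he)
    cases f with
    | unpushed c => exact absurd ⟨c, rfl⟩ (h _ List.mem_cons_self)
    | pushed c => simpa using this
    | pulled => simpa using this

theorem ownActs_eq_map_pushedOps (h : ∀ e ∈ L, ¬ e.IsUnpushed) :
    ownActs L = (pushedOps L).map Op.toAct := by
  rw [← map_ownOps_eq_pushedOps h, ownActs, List.map_map]
  rfl

end Own

end

section

variable {Code Call State Lock : Type*} {N : ℕ}

/-- The unpushed operations of a local log. -/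
def unpushedOps (L : List (LocalEntry Code Call State)) : List (Op Call State) :=
  L.filterMap fun e => match e.flag with
    | .unpushed _ => some e.op
    | _ => none

section Own

variable {L L' : List (LocalEntry Code Call State)} {o : Op Call State} {c : Code}

@[simp] theorem unpushedOps_nil : unpushedOps ([] : List (LocalEntry Code Call State)) = [] := rfl

@[simp] theorem unpushedOps_append : unpushedOps (L ++ L') = unpushedOps L ++ unpushedOps L' := by
  simp [unpushedOps]

@[simp] theorem unpushedOps_cons_unpushed :
    unpushedOps (⟨o, .unpushed c⟩ :: L) = o :: unpushedOps L := rfl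

@[simp] theorem unpushedOps_cons_pushed :
    unpushedOps (⟨o, .pushed c⟩ :: L) = unpushedOps L := rfl

@[simp] theorem unpushedOps_cons_pulled : unpushedOps (⟨o, .pulled⟩ :: L) = unpushedOps L := rfl

theorem mem_ownOps_of_mem_unpushedOps (h : o ∈ unpushedOps L) : ∃ c, (c, o) ∈ ownOps L := by
  obtain ⟨⟨o', f⟩, he, h⟩ := List.mem_filterMap.1 h
  cases f with
  | unpushed c =>
    simp only [Option.some.injEq] at h
    subst h
    exact mem_ownOps_of_not_isPulled he (by simp [LocalEntry.IsPulled])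
  | pushed c => simp at h
  | pulled => simp at h

theorem mem_of_mem_ownOps {p : Code × Op Call State} (h : p ∈ ownOps L) :
    ∃ e ∈ L, e.op = p.2 := by
  obtain ⟨⟨o', f⟩, he, h⟩ := List.mem_filterMap.1 h
  refine ⟨_, he, ?_⟩
  cases f <;> simp only [Option.some.injEq, reduceCtorEq] at h <;> subst h <;> rfl

end Own

/-! ## Frame properties of the steps -/

variable {M : Model Code Call State} {X Y : Config Code Call State N} {τ : Fin N} {r : Rule Call}

theorem CoreStep.thread_of_ne (h : CoreStep M X τ r Y) {τ' : Fin N} (hne : τ' ≠ τ) :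
    Y.thread τ' = X.thread τ' := by
  cases h <;> simp [Config.setThread, hne]

theorem CoreStep.code_eq_tx (h : CoreStep M X τ r Y) : ∃ c, (X.thread τ).code = .tx c := by
  cases h <;> simp [*]

/-- A commit changes only flags, so whatever depends just on the sequence of shared operations
survives it. -/
theorem map_op_commitShared (L : List (LocalEntry Code Call State))
    (G : List (SharedEntry Call State)) :
    (commitShared L G).map SharedEntry.op = G.map SharedEntry.op := by
  rw [commitShared, List.map_map]
  refine List.map_congr_left fun g _ => ?_
  simp only [Function.comp_apply]
  split_ifs <;> rfl

theorem sharedActs_eq_map (G : List (SharedEntry Call State)) :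
    sharedActs G = (G.map SharedEntry.op).map Op.toAct := by simp [sharedActs]

theorem mem_commitShared {L : List (LocalEntry Code Call State)}
    {G : List (SharedEntry Call State)} {o : Op Call State} :
    ⟨o, true⟩ ∈ commitShared L G ↔
      ⟨o, true⟩ ∈ G ∨ (⟨o, false⟩ ∈ G ∧ ∃ o' ∈ pushedOps L, o'.id = o.id) := by
  have key : ∀ g : SharedEntry Call State, (∃ e ∈ L, e.IsPushed ∧ e.op.id = g.op.id) ↔
      ∃ o' ∈ pushedOps L, o'.id = g.op.id := by
    intro g
    simp only [mem_pushedOps]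
    constructor
    · rintro ⟨e, h₁, h₂, h₃⟩; exact ⟨_, ⟨e, h₁, h₂, rfl⟩, h₃⟩
    · rintro ⟨_, ⟨e, h₁, h₂, rfl⟩, h₃⟩; exact ⟨e, h₁, h₂, h₃⟩
  simp only [commitShared, List.mem_map, key]
  constructor
  · rintro ⟨⟨o', b⟩, hg, h⟩
    split_ifs at h with hc
    · cases h
      cases b
      · exact Or.inr ⟨hg, hc⟩
      · exact Or.inl hg
    · cases h; exact Or.inl hg
  · rintro (h | ⟨h, hc⟩)
    · exact ⟨_, h, by simp⟩
    · exact ⟨_, h, by simp [hc]⟩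

theorem mem_commitShared_false {L : List (LocalEntry Code Call State)}
    {G : List (SharedEntry Call State)} {o : Op Call State} :
    ⟨o, false⟩ ∈ commitShared L G ↔ ⟨o, false⟩ ∈ G ∧ ∀ o' ∈ pushedOps L, o'.id ≠ o.id := by
  simp only [commitShared, List.mem_map]
  constructor
  · rintro ⟨⟨o', b⟩, hg, h⟩
    split_ifs at h with hc
    · cases h
    · cases h
      refine ⟨hg, fun o'' ho' hid => hc ?_⟩
      obtain ⟨e, h₁, h₂, rfl⟩ := mem_pushedOps.1 ho'
      exact ⟨e, h₁, h₂, hid⟩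
  · rintro ⟨h, hc⟩
    refine ⟨_, h, ?_⟩
    rw [if_neg]
    rintro ⟨e, h₁, h₂, h₃⟩
    exact hc _ (mem_pushedOps.2 ⟨e, h₁, h₂, rfl⟩) h₃

theorem CoreStep.allowed (h : CoreStep M X τ r Y) (hX : M.allowed (sharedActs X.shared)) :
    M.allowed (sharedActs Y.shared) := by
  cases h with
  | app _ _ _ _ => exact hX
  | unapp _ => exact hX
  | push _ _ h => simpa [sharedActs] using h
  | unpush _ _ _ h => exact h
  | pull _ _ _ _ _ => exact hX
  | unpull _ _ => exact hX
  | cmt _ _ _ _ => rwa [sharedActs_eq_map, map_op_commitShared, ← sharedActs_eq_map]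

/-! ## Threads execute their programs -/

/-- Each running thread has executed its own operations, starting from its initial code and
state, and a finished thread has an empty log. -/
structure ExecInv (M : Model Code Call State) (init : Fin N → Code × State)
    (X : Config Code Call State N) : Prop where
  exec : ∀ τ c, (X.thread τ).code = .tx c →
    M.Exec (init τ).1 (init τ).2 (ownOps (X.thread τ).log) c (X.thread τ).loc
  skip : ∀ τ, (X.thread τ).code = .skip → (X.thread τ).log = []

theorem ExecInv.start (M : Model Code Call State) (init : Fin N → Code × State) :
    ExecInv M init (Config.start init) where
  exec τ c h := by
    simp only [Config.start, TxCode.tx.injEq] at h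
    exact ⟨h, rfl⟩
  skip τ h := by simp [Config.start] at h

theorem ExecInv.of_thread {init : Fin N → Code × State} (hX : ExecInv M init X)
    (hne : ∀ τ' ≠ τ, Y.thread τ' = X.thread τ')
    (he : ∀ c, (Y.thread τ).code = .tx c →
      M.Exec (init τ).1 (init τ).2 (ownOps (Y.thread τ).log) c (Y.thread τ).loc)
    (hs : (Y.thread τ).code = .skip → (Y.thread τ).log = []) : ExecInv M init Y where
  exec τ' c h := by
    by_cases hτ : τ' = τ
    · subst hτ; exact he c h
    · rw [hne τ' hτ] at h ⊢; exact hX.exec τ' c h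
  skip τ' h := by
    by_cases hτ : τ' = τ
    · subst hτ; exact hs h
    · rw [hne τ' hτ] at h ⊢; exact hX.skip τ' h

/-- APP extends the execution by one operation and UNAPP removes the last; the other rules that keep
the transaction running leave its own operations in place. This is why the execution is annotated
with code: the code stored for rollback must be the code actually reached there. -/
theorem ExecInv.step {init : Fin N → Code × State} (hX : ExecInv M init X)
    (h : CoreStep M X τ r Y) : ExecInv M init Y := by
  have hne : ∀ τ' ≠ τ, Y.thread τ' = X.thread τ' := fun _ => h.thread_of_ne
  have hex := hX.exec τ
  refine hX.of_thread hne ?_ ?_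
  · cases h with
    | app hτ hs ha hf =>
      simp only [hτ, Config.setThread, Function.update_self, TxCode.tx.injEq, forall_eq',
        ownOps_append, ownOps_cons_unpushed, ownOps_nil] at hex ⊢
      exact Model.exec_append.2 ⟨_, _, hex, rfl, rfl, _, hs, rfl, rfl⟩
    | unapp hτ =>
      simp only [hτ, Config.setThread, Function.update_self, TxCode.tx.injEq, forall_eq',
        ownOps_append, ownOps_cons_unpushed, ownOps_nil] at hex ⊢
      -- The annotations identify the restored code and state with the end of the execution without
      -- its last operation.
      obtain ⟨c₁, σ₁, h₁, h₂, h₃, _⟩ := Model.exec_append.1 hex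
      simp only at h₂ h₃
      subst h₂ h₃
      exact h₁
    | push hτ _ _ => simpa [hτ] using hex
    | unpush hτ _ _ _ => simpa [hτ] using hex
    | pull hτ _ _ _ _ => simpa [hτ, Config.setThread] using hex
    | unpull hτ _ => simpa [hτ, Config.setThread] using hex
    | cmt hτ _ _ _ => simp
  · cases h <;> simp [Config.setThread]

/-! ## Identifiers -/

/-- Identifiers are unique, and the uncommitted operations of the shared log are those that are
pushed in a local log. -/
structure IdInv (X : Config Code Call State N) : Prop where
  nodup : (X.shared.map fun g => g.op.id).Nodup
  own_nodup : ∀ τ, ((ownOps (X.thread τ).log).map fun p => p.2.id).Nodup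
  own_disj : ∀ τ τ', τ ≠ τ' → ∀ p ∈ ownOps (X.thread τ).log, ∀ q ∈ ownOps (X.thread τ').log,
    p.2.id ≠ q.2.id
  pushed_mem : ∀ τ, ∀ o ∈ pushedOps (X.thread τ).log, ⟨o, false⟩ ∈ X.shared
  mem_pushed : ∀ o, ⟨o, false⟩ ∈ X.shared → ∃ τ, o ∈ pushedOps (X.thread τ).log
  unpushed_id : ∀ τ, ∀ o ∈ unpushedOps (X.thread τ).log, ∀ g ∈ X.shared, g.op.id ≠ o.id

theorem IdInv.start (init : Fin N → Code × State) :
    IdInv (Config.start (Call := Call) init) := by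
  constructor <;> simp [Config.start]

theorem IdInv.nodup_op (h : IdInv X) : (X.shared.map SharedEntry.op).Nodup := by
  refine List.Nodup.of_map Op.id ?_
  simpa [Function.comp_def] using h.nodup

theorem IdInv.eq_of_id (h : IdInv X) {g g' : SharedEntry Call State} (hg : g ∈ X.shared)
    (hg' : g' ∈ X.shared) (hid : g.op.id = g'.op.id) : g = g' :=
  List.inj_on_of_nodup_map h.nodup hg hg' hid

theorem IdInv.own_eq_of_id (h : IdInv X) {τ τ' : Fin N} {p q : Code × Op Call State}
    (hp : p ∈ ownOps (X.thread τ).log) (hq : q ∈ ownOps (X.thread τ').log)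
    (hid : p.2.id = q.2.id) : τ = τ' ∧ p = q := by
  by_cases hτ : τ = τ'
  · subst hτ
    exact ⟨rfl, List.inj_on_of_nodup_map (h.own_nodup τ) hp hq hid⟩
  · exact absurd hid (h.own_disj _ _ hτ _ hp _ hq)

theorem IdInv.pushed_eq_of_id (h : IdInv X) {τ τ' : Fin N} {o o' : Op Call State}
    (ho : o ∈ pushedOps (X.thread τ).log) (ho' : o' ∈ pushedOps (X.thread τ').log)
    (hid : o.id = o'.id) : τ = τ' ∧ o = o' := by
  obtain ⟨c, hc⟩ := mem_ownOps_of_mem_pushedOps ho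
  obtain ⟨c', hc'⟩ := mem_ownOps_of_mem_pushedOps ho'
  obtain ⟨h₁, h₂⟩ := h.own_eq_of_id hc hc' hid
  exact ⟨h₁, (Prod.mk.inj h₂).2⟩

theorem IdInv.nodup_pushedOps (h : IdInv X) (τ : Fin N) :
    (pushedOps (X.thread τ).log).Nodup := by
  have := h.own_nodup τ
  have h' : (((ownOps (X.thread τ).log).map Prod.snd).map Op.id).Nodup := by
    simpa [Function.comp_def] using this
  exact h'.of_map.sublist pushedOps_sublist

/-- Steps that leave the own operations and the shared log unchanged. -/
theorem IdInv.of_same (hX : IdInv X) (hs : Y.shared = X.shared)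
    (h₁ : ∀ τ, ownOps (Y.thread τ).log = ownOps (X.thread τ).log)
    (h₂ : ∀ τ, pushedOps (Y.thread τ).log = pushedOps (X.thread τ).log)
    (h₃ : ∀ τ, unpushedOps (Y.thread τ).log = unpushedOps (X.thread τ).log) : IdInv Y where
  nodup := hs ▸ hX.nodup
  own_nodup τ := h₁ τ ▸ hX.own_nodup τ
  own_disj τ τ' := by rw [h₁, h₁]; exact hX.own_disj τ τ'
  pushed_mem τ := by rw [h₂, hs]; exact hX.pushed_mem τ
  mem_pushed o := by simp only [h₂, hs]; exact hX.mem_pushed o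
  unpushed_id τ := by rw [h₃, hs]; exact hX.unpushed_id τ

theorem forall_ne_update {ι β : Type*} [DecidableEq ι] {f : ι → β} {i : ι} {b : β}
    {R : β → β → Prop} (hR : ∀ x y, R x y → R y x) (h : ∀ j k, j ≠ k → R (f j) (f k))
    (hb : ∀ j ≠ i, R b (f j)) :
    ∀ j k, j ≠ k → R (Function.update f i b j) (Function.update f i b k) := by
  intro j k hjk
  by_cases hj : j = i
  · subst hj
    rw [Function.update_self, Function.update_of_ne hjk.symm]
    exact hb k hjk.symm
  · rw [Function.update_of_ne hj]
    by_cases hk : k = i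
    · subst hk
      rw [Function.update_self]
      exact hR _ _ (hb j hj)
    · rw [Function.update_of_ne hk]
      exact h j k hjk

theorem forall_update_thread {t : Thread Code Call State} {P : Thread Code Call State → Prop}
    (ht : P t) (h : ∀ τ' ≠ τ, P (X.thread τ')) : ∀ τ', P (Function.update X.thread τ t τ') := by
  intro τ'
  by_cases hτ : τ' = τ
  · subst hτ
    rwa [Function.update_self]
  · rw [Function.update_of_ne hτ]
    exact h τ' hτ

theorem IdInv.own_disj_update (hX : IdInv X) {t : Thread Code Call State}
    (ht : ∀ τ' ≠ τ, ∀ p ∈ ownOps t.log, ∀ q ∈ ownOps (X.thread τ').log, p.2.id ≠ q.2.id) :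
    ∀ τ₁ τ₂, τ₁ ≠ τ₂ → ∀ p ∈ ownOps (Function.update X.thread τ t τ₁).log,
      ∀ q ∈ ownOps (Function.update X.thread τ t τ₂).log, p.2.id ≠ q.2.id :=
  forall_ne_update (R := fun t t' : Thread Code Call State =>
      ∀ p ∈ ownOps t.log, ∀ q ∈ ownOps t'.log, p.2.id ≠ q.2.id)
    (fun _ _ h p hp q hq => (h q hq p hp).symm) hX.own_disj ht

/-- Only APP creates an identifier, and its freshness ranges over all logs. PUSH and UNPUSH change a
local flag together with the presence of the operation in the shared log. CMT selects entries by
identifier, so uniqueness is what keeps it from committing operations of others. -/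
theorem IdInv.step (hX : IdInv X) (h : CoreStep M X τ r Y) : IdInv Y := by
  have hnd := hX.own_nodup τ
  have hdj := fun τ' (hne : τ' ≠ τ) => hX.own_disj τ τ' hne.symm
  have hpm := hX.pushed_mem τ
  have hui := hX.unpushed_id τ
  cases h with
  | @app c σ L m c' σ' id hτ hs ha hf =>
    simp only [hτ] at hnd hdj hpm hui
    have hid : ∀ τ', ∀ p ∈ ownOps (X.thread τ').log, p.2.id ≠ id := by
      intro τ' p hp
      obtain ⟨e, he, hep⟩ := mem_of_mem_ownOps hp
      exact hep ▸ hf.1 τ' e he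
    have hidτ := hid τ
    simp only [hτ] at hidτ
    refine ⟨hX.nodup, ?_, hX.own_disj_update ?_, ?_, ?_, ?_⟩
    · refine forall_update_thread (P := fun t => List.Nodup ((ownOps t.log).map
        fun p => p.2.id)) ?_ (fun τ' _ => hX.own_nodup τ')
      simp only [ownOps_append, ownOps_cons_unpushed, ownOps_nil, List.map_append, List.map_cons,
        List.map_nil]
      refine List.Nodup.append hnd (by simp) ?_
      simp only [List.disjoint_singleton, List.mem_map, not_exists, not_and]
      exact fun p hp => hidτ p hp
    · intro τ' hne p hp q hq
      simp only [ownOps_append, ownOps_cons_unpushed, ownOps_nil, List.mem_append,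
        List.mem_singleton] at hp
      rcases hp with hp | rfl
      · exact hdj τ' hne p hp q hq
      · exact (hid τ' q hq).symm
    · refine forall_update_thread (P := fun t => ∀ o ∈ pushedOps t.log,
        ⟨o, false⟩ ∈ X.shared)
        ?_ (fun τ' _ => hX.pushed_mem τ')
      simpa using hpm
    · intro o ho
      obtain ⟨τ', h'⟩ := hX.mem_pushed o ho
      refine ⟨τ', ?_⟩
      by_cases hne : τ' = τ
      · subst hne
        rw [hτ] at h'
        simpa [Config.setThread] using h'
      · simpa [Config.setThread, hne] using h'
    · refine forall_update_thread (P := fun t => ∀ o ∈ unpushedOps t.log,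
        ∀ g ∈ X.shared, g.op.id ≠ o.id)
        ?_ (fun τ' _ => hX.unpushed_id τ')
      intro o ho
      simp only [unpushedOps_append, unpushedOps_cons_unpushed, unpushedOps_nil, List.mem_append,
        List.mem_singleton] at ho
      rcases ho with ho | rfl
      · exact hui o ho
      · exact hf.2
  | @unapp c c' σ L o hτ =>
    simp only [hτ, ownOps_append, ownOps_cons_unpushed, ownOps_nil, List.map_append,
      unpushedOps_append, unpushedOps_cons_unpushed, unpushedOps_nil, List.mem_append,
      pushedOps_append, pushedOps_cons_unpushed, pushedOps_nil] at hnd hdj hpm hui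
    refine ⟨hX.nodup, ?_, hX.own_disj_update ?_, ?_, ?_, ?_⟩
    · refine forall_update_thread (P := fun t => List.Nodup ((ownOps t.log).map
        fun p => p.2.id)) ?_ (fun τ' _ => hX.own_nodup τ')
      exact hnd.of_append_left
    · exact fun τ' hne p hp => hdj τ' hne p (Or.inl hp)
    · refine forall_update_thread (P := fun t => ∀ o ∈ pushedOps t.log,
        ⟨o, false⟩ ∈ X.shared)
        ?_ (fun τ' _ => hX.pushed_mem τ')
      simpa using hpm
    · intro o ho
      obtain ⟨τ', h'⟩ := hX.mem_pushed o ho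
      refine ⟨τ', ?_⟩
      by_cases hne : τ' = τ
      · subst hne
        rw [hτ] at h'
        simpa [Config.setThread] using h'
      · simpa [Config.setThread, hne] using h'
    · refine forall_update_thread (P := fun t => ∀ o ∈ unpushedOps t.log,
        ∀ g ∈ X.shared, g.op.id ≠ o.id)
        ?_ (fun τ' _ => hX.unpushed_id τ')
      exact fun o ho => hui o (Or.inl ho)
  | @push c σ L₁ L₂ o c₀ hτ hmv hal =>
    simp only [hτ, ownOps_append, ownOps_cons_unpushed, List.map_append,
      unpushedOps_append, unpushedOps_cons_unpushed, List.mem_append,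
      pushedOps_append, pushedOps_cons_unpushed] at hnd hdj hpm hui
    have hoG := hui o (by simp)
    refine ⟨?_, ?_, hX.own_disj_update ?_, ?_, ?_, ?_⟩
    · simp only [List.map_append, List.map_cons, List.map_nil]
      refine List.Nodup.append hX.nodup (by simp) ?_
      simp only [List.disjoint_singleton, List.mem_map, not_exists, not_and]
      exact hoG
    · refine forall_update_thread (P := fun t => List.Nodup ((ownOps t.log).map
        fun p => p.2.id)) ?_ (fun τ' _ => hX.own_nodup τ')
      simpa using hnd
    · intro τ' hne p hp
      exact hdj τ' hne p (by simpa using hp)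
    · refine forall_update_thread (P := fun t => ∀ o' ∈ pushedOps t.log,
        ⟨o', false⟩ ∈ X.shared ++ [⟨o, false⟩])
        ?_ (fun τ' _ o' ho' => List.mem_append_left _ (hX.pushed_mem τ' o' ho'))
      intro o' ho'
      simp only [pushedOps_append, pushedOps_cons_pushed, List.mem_append, List.mem_cons] at ho'
      rcases ho' with ho' | rfl | ho'
      · exact List.mem_append_left _ (hpm _ (Or.inl ho'))
      · simp
      · exact List.mem_append_left _ (hpm _ (Or.inr ho'))
    · intro o' ho'
      rw [List.mem_append, List.mem_singleton] at ho'
      rcases ho' with ho' | ho'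
      · obtain ⟨τ', h'⟩ := hX.mem_pushed o' ho'
        refine ⟨τ', ?_⟩
        by_cases hne : τ' = τ
        · subst hne
          rw [hτ] at h'
          simp only [pushedOps_append, pushedOps_cons_unpushed, List.mem_append] at h'
          simp only [Function.update_self, pushedOps_append, pushedOps_cons_pushed,
            List.mem_append, List.mem_cons]
          tauto
        · simpa [hne] using h'
      · cases ho'
        exact ⟨τ, by simp⟩
    · intro τ' o' ho' g hg
      rw [List.mem_append, List.mem_singleton] at hg
      by_cases hne : τ' = τ
      · subst hne
        simp only [Function.update_self, unpushedOps_append, unpushedOps_cons_pushed,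
          List.mem_append] at ho'
        rcases hg with hg | rfl
        · exact hui o' (by simp only [List.mem_cons]; tauto) g hg
        · simp only [List.map_cons] at hnd
          rw [List.nodup_middle, List.nodup_cons] at hnd
          intro hid
          apply hnd.1
          rw [List.mem_append]
          rcases ho' with ho' | ho'
          · obtain ⟨c, hc⟩ := mem_ownOps_of_mem_unpushedOps ho'
            exact Or.inl (List.mem_map.2 ⟨_, hc, hid.symm⟩)
          · obtain ⟨c, hc⟩ := mem_ownOps_of_mem_unpushedOps ho'
            exact Or.inr (List.mem_map.2 ⟨_, hc, hid.symm⟩)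
      · simp only [Function.update_of_ne hne] at ho'
        rcases hg with hg | rfl
        · exact hX.unpushed_id τ' o' ho' g hg
        · obtain ⟨c, hc⟩ := mem_ownOps_of_mem_unpushedOps ho'
          exact hdj τ' hne (c₀, o) (by simp) _ hc
  | @unpush c σ L₁ L₂ o c₀ G₁ G₂ hτ hG hmv hal =>
    simp only [hτ, ownOps_append, ownOps_cons_pushed, List.map_append,
      unpushedOps_append, unpushedOps_cons_pushed, List.mem_append,
      pushedOps_append, pushedOps_cons_pushed, List.mem_cons] at hnd hdj hpm hui
    have hn := hX.nodup
    rw [hG, List.map_append, List.map_cons, List.nodup_middle, List.nodup_cons,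
      ← List.map_append] at hn
    have hsub : ∀ g ∈ G₁ ++ G₂, g ∈ X.shared := by
      intro g hg
      rw [hG]
      rw [List.mem_append] at hg
      simp only [List.mem_append, List.mem_cons]
      tauto
    have hback : ∀ g ∈ X.shared, g.op.id ≠ o.id → g ∈ G₁ ++ G₂ := by
      intro g hg hid
      rw [hG] at hg
      simp only [List.mem_append, List.mem_cons] at hg ⊢
      rcases hg with hg | rfl | hg
      · exact Or.inl hg
      · exact absurd rfl hid
      · exact Or.inr hg
    have hoG : ∀ g ∈ G₁ ++ G₂, g.op.id ≠ o.id := fun g hg hid =>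
      hn.1 (List.mem_map.2 ⟨g, hg, hid⟩)
    have hoL : ∀ o' ∈ pushedOps L₁ ++ pushedOps L₂, o'.id ≠ o.id := by
      intro o' ho' hid
      simp only [List.map_cons] at hnd
      rw [List.nodup_middle, List.nodup_cons] at hnd
      apply hnd.1
      rw [List.mem_append] at ho' ⊢
      rcases ho' with ho' | ho'
      · obtain ⟨c, hc⟩ := mem_ownOps_of_mem_pushedOps ho'
        exact Or.inl (List.mem_map.2 ⟨_, hc, hid⟩)
      · obtain ⟨c, hc⟩ := mem_ownOps_of_mem_pushedOps ho'
        exact Or.inr (List.mem_map.2 ⟨_, hc, hid⟩)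
    refine ⟨hn.2, ?_, hX.own_disj_update ?_, ?_, ?_, ?_⟩
    · refine forall_update_thread (P := fun t => List.Nodup ((ownOps t.log).map
        fun p => p.2.id)) ?_ (fun τ' _ => hX.own_nodup τ')
      simpa using hnd
    · intro τ' hne p hp
      exact hdj τ' hne p (by simpa using hp)
    · refine forall_update_thread (P := fun t => ∀ o' ∈ pushedOps t.log,
        ⟨o', false⟩ ∈ G₁ ++ G₂)
        ?_ (fun τ' hne o' ho' => ?_)
      · intro o' ho'
        simp only [pushedOps_append, pushedOps_cons_unpushed] at ho'
        have := hoL o' ho'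
        rw [List.mem_append] at ho'
        exact hback _ (hpm o' (by tauto)) this
      · refine hback _ (hX.pushed_mem τ' o' ho') ?_
        obtain ⟨c, hc⟩ := mem_ownOps_of_mem_pushedOps ho'
        exact (hdj τ' hne (c₀, o) (by simp) _ hc).symm
    · intro o' ho'
      obtain ⟨τ', h'⟩ := hX.mem_pushed o' (hsub _ ho')
      refine ⟨τ', ?_⟩
      by_cases hne : τ' = τ
      · subst hne
        rw [hτ] at h'
        simp only [pushedOps_append, pushedOps_cons_pushed, List.mem_append, List.mem_cons] at h'
        simp only [Function.update_self, pushedOps_append, pushedOps_cons_unpushed,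
          List.mem_append]
        rcases h' with h' | rfl | h'
        · exact Or.inl h'
        · exact absurd rfl (hoG _ ho')
        · exact Or.inr h'
      · simpa [hne] using h'
    · refine forall_update_thread (P := fun t => ∀ o ∈ unpushedOps t.log,
        ∀ g ∈ G₁ ++ G₂, g.op.id ≠ o.id)
        ?_ (fun τ' _ o ho g hg => hX.unpushed_id τ' o ho g (hsub g hg))
      intro o' ho' g hg
      simp only [unpushedOps_append, unpushedOps_cons_unpushed, List.mem_append,
        List.mem_cons] at ho'
      rcases ho' with ho' | rfl | ho'
      · exact hui o' (Or.inl ho') g (hsub g hg)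
      · exact hoG g hg
      · exact hui o' (Or.inr ho') g (hsub g hg)
  | @pull c σ L g hτ hg hn hal hmv =>
    refine hX.of_same rfl ?_ ?_ ?_ <;> intro τ' <;> by_cases hne : τ' = τ <;>
      simp [Config.setThread, hne, hτ]
  | @unpull c σ L₁ L₂ o hτ hal =>
    refine hX.of_same rfl ?_ ?_ ?_ <;> intro τ' <;> by_cases hne : τ' = τ <;>
      simp [Config.setThread, hne, hτ]
  | @cmt c σ L hτ hf hun hpl =>
    have hids : ((commitShared L X.shared).map fun g => g.op.id) =
        X.shared.map fun g => g.op.id := by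
      have := congrArg (List.map Op.id) (map_op_commitShared L X.shared)
      simpa [Function.comp_def] using this
    refine ⟨hids ▸ hX.nodup, ?_, hX.own_disj_update (by simp), ?_, ?_, ?_⟩
    · refine forall_update_thread (P := fun t => List.Nodup ((ownOps t.log).map
        fun p => p.2.id)) ?_ (fun τ' _ => hX.own_nodup τ')
      simp
    · refine forall_update_thread (P := fun t => ∀ o' ∈ pushedOps t.log,
        ⟨o', false⟩ ∈ commitShared L X.shared)
        ?_ (fun τ' hne o' ho' => ?_)
      · simp
      refine mem_commitShared_false.2 ⟨hX.pushed_mem τ' o' ho', fun o ho hid => ?_⟩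
      -- An entry of another transaction would be marked only if its identifier were that of an
      -- operation pushed by `τ`, and then the two transactions would coincide.
      refine hne (hX.pushed_eq_of_id (τ := τ) (o := o) ?_ ho' hid).1.symm
      simpa [hτ] using ho
    · intro o' ho'
      obtain ⟨h₁, h₂⟩ := mem_commitShared_false.1 ho'
      obtain ⟨τ', h'⟩ := hX.mem_pushed o' h₁
      refine ⟨τ', ?_⟩
      by_cases hne : τ' = τ
      · subst hne
        rw [hτ] at h'
        exact absurd rfl (h₂ o' h')
      · simpa [hne] using h'
    · refine forall_update_thread (P := fun t => ∀ o ∈ unpushedOps t.log,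
        ∀ g ∈ commitShared L X.shared, g.op.id ≠ o.id)
        ?_ (fun τ' _ o ho g hg => ?_)
      · simp
      have : g.op.id ∈ X.shared.map fun g => g.op.id := hids ▸ List.mem_map.2 ⟨g, hg, rfl⟩
      obtain ⟨g', hg', he⟩ := List.mem_map.1 this
      exact he ▸ hX.unpushed_id τ' o ho g' hg'

end

section

variable {Code Call State Lock : Type*} {N : ℕ}
variable {M : Model Code Call State} {X Y : Config Code Call State N} {τ : Fin N} {r : Rule Call}

/-! ## Movers along a trace -/

/-- In a local log with the entry `e` before the entry `e'`, if `e'` is in the shared log `G` and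
`e` is not, or is later than `e'` in `G`, then `e'` moves right of `e`. -/
def MoverPair (M : Model Code Call State) (G : List (SharedEntry Call State))
    (e e' : LocalEntry Code Call State) : Prop :=
  e'.IsPushed → (e.IsUnpushed ∨ (e.IsPushed ∧ [e'.op, e.op].Sublist (G.map SharedEntry.op))) →
    M.Mover e'.op.toAct e.op.toAct

/-- Pushed operations of different transactions are movers. -/
def PairSafe (M : Model Code Call State) (X : Config Code Call State N) : Prop :=
  ∀ τ τ', τ ≠ τ' → ∀ o ∈ pushedOps (X.thread τ).log, ∀ o' ∈ pushedOps (X.thread τ').log,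
    M.Mover o.toAct o'.toAct

/-- The own operations of a transaction can be sorted into their local order, and the pushed ones
move right of the later operations of other transactions. -/
structure OrderInv (M : Model Code Call State) (X : Config Code Call State N) : Prop where
  movers : ∀ τ, (X.thread τ).log.Pairwise (MoverPair M X.shared)
  conflict : ∀ τ, ∀ o ∈ pushedOps (X.thread τ).log, ∀ x,
    [o, x].Sublist (X.shared.map SharedEntry.op) → x ∉ pushedOps (X.thread τ).log →
    M.Mover o.toAct x.toAct

theorem OrderInv.start (M : Model Code Call State) (init : Fin N → Code × State) :
    OrderInv M (Config.start (Call := Call) init) := by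
  constructor <;> simp [Config.start]

theorem MoverPair.mono {G G' : List (SharedEntry Call State)} {e e' : LocalEntry Code Call State}
    (h : MoverPair M G e e')
    (hG : e.IsPushed → e'.IsPushed → [e'.op, e.op].Sublist (G'.map SharedEntry.op) →
      [e'.op, e.op].Sublist (G.map SharedEntry.op)) : MoverPair M G' e e' := by
  rintro h₁ (h₂ | ⟨h₂, h₃⟩)
  · exact h h₁ (Or.inl h₂)
  · exact h h₁ (Or.inr ⟨h₂, hG h₂ h₁ h₃⟩)

theorem moverPair_of_not_isPushed {G : List (SharedEntry Call State)}
    {e e' : LocalEntry Code Call State} (h : ¬ e'.IsPushed) : MoverPair M G e e' :=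
  fun h' => absurd h' h

/-- Appending `z` creates only precedences whose later member is `z`. -/
theorem sublist_of_sublist_concat {α : Type*} {x y z : α} {l : List α}
    (h : [x, y].Sublist (l ++ [z])) (hy : y ≠ z) : [x, y].Sublist l := by
  rcases pair_sublist_append.1 h with h | h | h
  · exact h
  · have := h.length_le
    simp at this
  · exact absurd (List.mem_singleton.1 h.2) hy

theorem IdInv.not_mem_of_unpushed (hI : IdInv X) {o : Op Call State}
    (h : o ∈ unpushedOps (X.thread τ).log) : o ∉ X.shared.map SharedEntry.op := by
  intro ho
  obtain ⟨g, hg, rfl⟩ := List.mem_map.1 ho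
  exact hI.unpushed_id τ _ h g hg rfl

theorem IdInv.mem_map_op (hI : IdInv X) {o : Op Call State}
    (h : o ∈ pushedOps (X.thread τ).log) : o ∈ X.shared.map SharedEntry.op :=
  List.mem_map.2 ⟨_, hI.pushed_mem τ o h, rfl⟩

theorem mem_pushedOps_of_mem {L : List (LocalEntry Code Call State)}
    {e : LocalEntry Code Call State} (he : e ∈ L) (hp : e.IsPushed) : e.op ∈ pushedOps L :=
  mem_pushedOps.2 ⟨e, he, hp, rfl⟩

/-- Steps that keep the order of the operations of the shared log, and of the other local logs. -/
theorem OrderInv.of_same (hX : OrderInv M X)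
    (hs : Y.shared.map SharedEntry.op = X.shared.map SharedEntry.op)
    (hne : ∀ τ' ≠ τ, Y.thread τ' = X.thread τ')
    (hm : (Y.thread τ).log.Pairwise (MoverPair M X.shared))
    (hp : pushedOps (Y.thread τ).log = pushedOps (X.thread τ).log ∨ (Y.thread τ).log = []) :
    OrderInv M Y where
  movers τ' := by
    have : (Y.thread τ').log.Pairwise (MoverPair M X.shared) := by
      by_cases h : τ' = τ
      · subst h; exact hm
      · rw [hne τ' h]; exact hX.movers τ'
    exact this.imp fun h => h.mono fun _ _ => hs ▸ id
  conflict τ' := by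
    rw [hs]
    by_cases h : τ' = τ
    · subst h
      rcases hp with hp | hp
      · rw [hp]; exact hX.conflict τ'
      · simp [hp]
    · rw [hne τ' h]; exact hX.conflict τ'

/-- The pushed operation becomes last in the shared log, so only pairs in which it is the later
member are new there. If the earlier one belongs to another transaction, `PairSafe` after the step
provides the mover; this is the place where the missing condition of PUSH is made up for. Within the
transaction, the side condition handles earlier unpushed operations. -/
theorem OrderInv.push_step (hI : IdInv X) (hX : OrderInv M X) (hY : PairSafe M Y)
    {t t' : Thread Code Call State} {L₁ L₂ : List (LocalEntry Code Call State)}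
    {o : Op Call State} {c₀ : Code} (hτ : X.thread τ = t)
    (ht : t.log = L₁ ++ ⟨o, .unpushed c₀⟩ :: L₂) (ht' : t'.log = L₁ ++ ⟨o, .pushed c₀⟩ :: L₂)
    (hmv : ∀ e ∈ L₁, e.IsUnpushed → M.Mover o.toAct e.op.toAct)
    (hYt : Y.thread = Function.update X.thread τ t') (hYs : Y.shared = X.shared ++ [⟨o, false⟩]) :
    OrderInv M Y := by
  subst hτ
  have hoG : o ∉ X.shared.map SharedEntry.op := hI.not_mem_of_unpushed (τ := τ) (by simp [ht])
  have hmono : ∀ x y, y ∈ X.shared.map SharedEntry.op →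
      [x, y].Sublist (Y.shared.map SharedEntry.op) →
      [x, y].Sublist (X.shared.map SharedEntry.op) := by
    intro x y hy h
    rw [hYs, List.map_append] at h
    exact sublist_of_sublist_concat h fun h => hoG ((show y = o from h) ▸ hy)
  have hold : ∀ L : List (LocalEntry Code Call State), L.Pairwise (MoverPair M X.shared) →
      (∀ e ∈ L, e.IsPushed → e.op ∈ X.shared.map SharedEntry.op) →
      L.Pairwise (MoverPair M Y.shared) := fun L hL hmem =>
    hL.imp_of_mem fun he _ h => h.mono fun hp _ => hmono _ _ (hmem _ he hp)
  constructor
  · intro τ'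
    rw [hYt]
    by_cases hne : τ' = τ
    · subst hne
      rw [Function.update_self, ht']
      have hm := hX.movers τ'
      have hmem : ∀ e ∈ (X.thread τ').log, e.IsPushed → e.op ∈ X.shared.map SharedEntry.op :=
        fun e he hp => hI.mem_map_op (mem_pushedOps_of_mem he hp)
      rw [ht] at hm hmem
      rw [List.pairwise_append, List.pairwise_cons] at hm ⊢
      obtain ⟨h₁, ⟨h₂, h₃⟩, h₄⟩ := hm
      refine ⟨hold _ h₁ fun e he => hmem e (by simp [he]),
        ⟨?_, hold _ h₃ fun e he => hmem e (by simp [he])⟩, ?_⟩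
      · exact fun e' he' hp _ => h₂ e' he' hp (Or.inl ⟨_, rfl⟩)
      · intro e he e' he'
        rw [List.mem_cons] at he'
        rcases he' with rfl | he'
        · rintro - (h | ⟨h, hs⟩)
          · exact hmv e he h
          -- Here `o` would precede `e` in the shared log, but `o` has just been appended.
          · exact absurd (pair_sublist_mem (hmono _ _ (hmem e (by simp [he]) h) hs)).1 hoG
        · exact (h₄ e he e' (List.mem_cons_of_mem _ he')).mono fun hp _ =>
            hmono _ _ (hmem e (by simp [he]) hp)
    · rw [Function.update_of_ne hne]
      exact hold _ (hX.movers τ') fun e he hp => hI.mem_map_op (mem_pushedOps_of_mem he hp)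
  · intro τ' o' ho' x hs hx
    by_cases hxo : x = o
    · subst hxo
      have hxY : x ∈ pushedOps (Y.thread τ).log := by simp [hYt, ht']
      exact hY τ' τ (fun h => hx (h ▸ hxY)) o' ho' x hxY
    · rw [hYs, List.map_append] at hs
      have hs' := sublist_of_sublist_concat hs hxo
      rw [hYt] at ho' hx
      by_cases hne : τ' = τ
      · subst hne
        rw [Function.update_self, ht'] at ho' hx
        have hc := hX.conflict τ'
        rw [ht] at hc
        simp only [pushedOps_append, pushedOps_cons_pushed, pushedOps_cons_unpushed,
          List.mem_append, List.mem_cons, not_or] at ho' hx hc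
        refine hc o' ?_ x hs' ⟨hx.1, hx.2.2⟩
        rcases ho' with ho' | rfl | ho'
        · exact Or.inl ho'
        · exact absurd (pair_sublist_mem hs').1 hoG
        · exact Or.inr ho'
      · rw [Function.update_of_ne hne] at ho' hx
        exact hX.conflict τ' o' ho' x hs' hx

/-- Withdrawing an operation only removes precedences from the shared log. The one new demand is
that later own operations that stay pushed are movers past the withdrawn one, which is the side
condition of UNPUSH. -/
theorem OrderInv.unpush_step (hI : IdInv X) (hX : OrderInv M X)
    {t t' : Thread Code Call State} {L₁ L₂ : List (LocalEntry Code Call State)}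
    {o : Op Call State} {c₀ : Code} {G₁ G₂ : List (SharedEntry Call State)} (hτ : X.thread τ = t)
    (ht : t.log = L₁ ++ ⟨o, .pushed c₀⟩ :: L₂) (ht' : t'.log = L₁ ++ ⟨o, .unpushed c₀⟩ :: L₂)
    (hG : X.shared = G₁ ++ ⟨o, false⟩ :: G₂)
    (hmv : ∀ e ∈ L₂, e.IsPushed → M.Mover e.op.toAct o.toAct)
    (hYt : Y.thread = Function.update X.thread τ t') (hYs : Y.shared = G₁ ++ G₂) :
    OrderInv M Y := by
  subst hτ
  have hsub : (Y.shared.map SharedEntry.op).Sublist (X.shared.map SharedEntry.op) := by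
    rw [hYs, hG]
    exact (List.Sublist.append_left (List.sublist_cons_self _ _) _).map _
  have hoY : o ∉ Y.shared.map SharedEntry.op := by
    have := hI.nodup_op
    rw [hG, List.map_append, List.map_cons, List.nodup_middle, List.nodup_cons,
      ← List.map_append] at this
    rw [hYs]
    exact this.1
  have hold : ∀ L : List (LocalEntry Code Call State), L.Pairwise (MoverPair M X.shared) →
      L.Pairwise (MoverPair M Y.shared) := fun L hL =>
    hL.imp fun h => h.mono fun _ _ hs => hs.trans hsub
  constructor
  · intro τ'
    rw [hYt]
    by_cases hne : τ' = τ
    · subst hne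
      rw [Function.update_self, ht']
      have hm := hX.movers τ'
      rw [ht] at hm
      rw [List.pairwise_append, List.pairwise_cons] at hm ⊢
      obtain ⟨h₁, ⟨h₂, h₃⟩, h₄⟩ := hm
      refine ⟨hold _ h₁, ⟨fun e' he' hp _ => hmv e' he' hp, hold _ h₃⟩, ?_⟩
      intro e he e' he'
      rw [List.mem_cons] at he'
      rcases he' with rfl | he'
      · exact moverPair_of_not_isPushed (by simp [LocalEntry.IsPushed])
      · exact (h₄ e he e' (List.mem_cons_of_mem _ he')).mono fun _ _ hs => hs.trans hsub
    · rw [Function.update_of_ne hne]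
      exact hold _ (hX.movers τ')
  · intro τ' o' ho' x hs hx
    rw [hYt] at ho' hx
    by_cases hne : τ' = τ
    · subst hne
      rw [Function.update_self, ht'] at ho' hx
      have hc := hX.conflict τ'
      rw [ht] at hc
      simp only [pushedOps_append, pushedOps_cons_pushed, pushedOps_cons_unpushed,
        List.mem_append, List.mem_cons, not_or] at ho' hx hc
      -- Since `o` is no longer pushed, `x = o` has to be excluded separately: `o` has left the
      -- shared log.
      refine hc o' (by tauto) x (hs.trans hsub) ⟨hx.1, ?_, hx.2⟩
      rintro rfl
      exact hoY (pair_sublist_mem hs).2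
    · rw [Function.update_of_ne hne] at ho' hx
      exact hX.conflict τ' o' ho' x (hs.trans hsub) hx

/-- Entries appended by APP and PULL are not pushed and carry no obligation; `PairSafe` enters only
through PUSH. -/
theorem OrderInv.step (hI : IdInv X) (hX : OrderInv M X) (hY : PairSafe M Y)
    (h : CoreStep M X τ r Y) : OrderInv M Y := by
  have hne : ∀ τ' ≠ τ, Y.thread τ' = X.thread τ' := fun _ => h.thread_of_ne
  have hm := hX.movers τ
  cases h with
  | app hτ hs ha hf =>
    refine hX.of_same rfl hne ?_ (Or.inl (by simp [Config.setThread, hτ]))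
    rw [hτ] at hm
    simp only [Config.setThread, Function.update_self]
    refine List.pairwise_append.2 ⟨hm, by simp, fun e _ e' he' => ?_⟩
    rw [List.mem_singleton] at he'
    subst he'
    exact moverPair_of_not_isPushed (by simp [LocalEntry.IsPushed])
  | unapp hτ =>
    refine hX.of_same rfl hne ?_ (Or.inl (by simp [Config.setThread, hτ]))
    rw [hτ] at hm
    simpa [Config.setThread] using (List.pairwise_append.1 hm).1
  | push hτ hmv hal => exact hX.push_step hI hY hτ rfl rfl hmv rfl rfl
  | unpush hτ hG hmv hal => exact hX.unpush_step hI hτ rfl rfl hG hmv rfl rfl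
  | pull hτ hg hn hal hmv =>
    refine hX.of_same rfl hne ?_ (Or.inl (by simp [Config.setThread, hτ]))
    rw [hτ] at hm
    simp only [Config.setThread, Function.update_self]
    refine List.pairwise_append.2 ⟨hm, by simp, fun e _ e' he' => ?_⟩
    rw [List.mem_singleton] at he'
    subst he'
    exact moverPair_of_not_isPushed (by simp [LocalEntry.IsPushed])
  | unpull hτ hal =>
    refine hX.of_same rfl hne ?_ (Or.inl (by simp [Config.setThread, hτ]))
    rw [hτ] at hm
    simp only [Config.setThread, Function.update_self]
    exact hm.sublist (List.Sublist.append_left (List.sublist_cons_self _ _) _)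
  | cmt hτ hf hun hpl =>
    exact hX.of_same (map_op_commitShared _ _) hne (by simp) (Or.inr (by simp))

/-! ## Commits -/

theorem committedActs_eq_map (G : List (SharedEntry Call State)) :
    committedActs G = ((G.filter fun g => g.committed).map SharedEntry.op).map Op.toAct :=
  sharedActs_eq_map _

/-- The committed part of the shared log is permitted: the uncommitted operations move right. -/
theorem OrderInv.allowed_committed (hI : IdInv X) (hX : OrderInv M X)
    (ha : M.allowed (sharedActs X.shared)) : M.allowed (committedActs X.shared) := by
  refine Model.allowed_of_append (Model.LogLE.allowed (Model.logLE_filter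
    (fun g : SharedEntry Call State => g.op.toAct) (fun g => g.committed) ?_) ha)
  rintro ⟨o, b⟩ ⟨x, b'⟩ hs hb hb'
  simp only at hb hb'
  subst hb hb'
  have hmem := pair_sublist_mem hs
  obtain ⟨τ, hτ⟩ := hI.mem_pushed o hmem.1
  -- The later operation `x` is committed, while everything that `τ` has pushed is still
  -- uncommitted.
  refine hX.conflict τ o hτ x (hs.map SharedEntry.op) fun hx => ?_
  have := hI.eq_of_id hmem.2 (hI.pushed_mem τ x hx) rfl
  simp at this

/-- On commit, the operations of the transaction can be moved to the end of the committed part of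
the shared log, in their local order. -/
theorem OrderInv.commit_logLE (hI : IdInv X) (hX : OrderInv M X)
    {L : List (LocalEntry Code Call State)} (hL : (X.thread τ).log = L) :
    M.LogLE (committedActs (commitShared L X.shared))
      (committedActs X.shared ++ (pushedOps L).map Op.toAct) := by
  subst hL
  set L := (X.thread τ).log with hL
  have hpn : (pushedOps L).Nodup := hI.nodup_pushedOps τ
  have hcn : ((X.shared.filter fun g => g.committed).map SharedEntry.op).Nodup :=
    hI.nodup_op.sublist (List.filter_sublist.map _)
  have hmemc : ∀ o, o ∈ (X.shared.filter fun g => g.committed).map SharedEntry.op ↔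
      ⟨o, true⟩ ∈ X.shared := by
    intro o
    simp only [List.mem_map, List.mem_filter]
    constructor
    · rintro ⟨⟨o', b⟩, ⟨hg, hb⟩, rfl⟩
      simp only at hb
      exact hb ▸ hg
    · exact fun h => ⟨_, ⟨h, rfl⟩, rfl⟩
  have hdisj : ∀ o, ⟨o, true⟩ ∈ X.shared → o ∉ pushedOps L := by
    intro o ho ho'
    have := hI.eq_of_id ho (hI.pushed_mem τ o ho') rfl
    simp at this
  have htn : ((X.shared.filter fun g => g.committed).map SharedEntry.op ++ pushedOps L).Nodup :=
    List.Nodup.append hcn hpn fun o ho => hdisj o ((hmemc o).1 ho)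
  have hsubl : (((commitShared L X.shared).filter fun g => g.committed).map
      SharedEntry.op).Sublist (X.shared.map SharedEntry.op) := by
    rw [← map_op_commitShared L X.shared]
    exact List.filter_sublist.map _
  have hmeml : ∀ o, o ∈ ((commitShared L X.shared).filter fun g => g.committed).map
      SharedEntry.op ↔ ⟨o, true⟩ ∈ commitShared L X.shared := by
    intro o
    simp only [List.mem_map, List.mem_filter]
    constructor
    · rintro ⟨⟨o', b⟩, ⟨hg, hb⟩, rfl⟩
      simp only at hb
      exact hb ▸ hg
    · exact fun h => ⟨_, ⟨h, rfl⟩, rfl⟩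
  have hperm : (((commitShared L X.shared).filter fun g => g.committed).map SharedEntry.op).Perm
      ((X.shared.filter fun g => g.committed).map SharedEntry.op ++ pushedOps L) := by
    rw [List.perm_ext_iff_of_nodup (hI.nodup_op.sublist hsubl) htn]
    intro o
    rw [hmeml, mem_commitShared, List.mem_append, hmemc]
    refine or_congr_right ⟨?_, fun h => ⟨hI.pushed_mem τ o h, o, h, rfl⟩⟩
    rintro ⟨h₁, o', h₂, h₃⟩
    have := hI.eq_of_id h₁ (hI.pushed_mem τ o' h₂) h₃.symm
    simp only [SharedEntry.mk.injEq, and_true] at this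
    exact this ▸ h₂
  have hmain := Model.logLE_of_perm (M := M) Op.toAct hperm htn ?_ []
  · rw [committedActs_eq_map, committedActs_eq_map, ← List.map_append]
    simpa using hmain
  · intro x y hxy hyx
    have hxyG := hxy.trans hsubl
    -- A pair whose order changes: two previously committed operations keep their order, two
    -- operations of `τ` fall under `movers`, and an operation of `τ` before a committed one falls
    -- under `conflict`.
    rcases pair_sublist_append.1 hyx with h | h | ⟨h₁, h₂⟩
    · exact absurd (h.trans (List.filter_sublist.map _)) (pair_sublist_asymm hI.nodup_op hxyG)
    · have hpw : (pushedOps L).Pairwise fun y x =>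
          [x, y].Sublist (X.shared.map SharedEntry.op) → M.Mover x.toAct y.toAct := by
        refine List.pairwise_filterMap.2 ((hX.movers τ).imp ?_)
        rintro ⟨o, f⟩ ⟨o', f'⟩ he y' hy x' hx' hs
        cases f <;> simp only [reduceCtorEq, Option.some.injEq] at hy
        cases f' <;> simp only [reduceCtorEq, Option.some.injEq] at hx'
        subst hy hx'
        exact he ⟨_, rfl⟩ (Or.inr ⟨⟨_, rfl⟩, hs⟩)
      exact List.pairwise_iff_forall_sublist.1 hpw h hxyG
    · exact hX.conflict τ x h₂ y hxyG (hdisj y ((hmemc y).1 h₁))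

end

/-! ### The combined invariant, and serial histories as atomic traces. -/

section

variable {Code Call State Lock : Type*} {N : ℕ}
variable {M : Model Code Call State} {X Y : Config Code Call State N} {τ : Fin N} {r : Rule Call}
variable {init : Fin N → Code × State}

/-- The invariants of the machine. -/
structure Inv (M : Model Code Call State) (init : Fin N → Code × State)
    (X : Config Code Call State N) : Prop where
  exec : ExecInv M init X
  ids : IdInv X
  order : OrderInv M X
  allowed : M.allowed (sharedActs X.shared)

theorem Inv.start (M : Model Code Call State) (init : Fin N → Code × State) :
    Inv M init (Config.start init) :=
  ⟨.start M init, .start init, .start M init, M.allowed_nil⟩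

theorem Inv.step (hX : Inv M init X) (hY : PairSafe M Y) (h : CoreStep M X τ r Y) :
    Inv M init Y :=
  ⟨hX.exec.step h, hX.ids.step h, hX.order.step hX.ids hY h, h.allowed hX.allowed⟩

/-! ## Serial histories -/

/-- A finished transaction: its operations, and its final local state. -/
structure Done (Call State : Type*) (N : ℕ) where
  tx : Fin N
  acts : List (Act Call State)
  st : State

/-- The log of a history. -/
def histActs (h : List (Done Call State N)) : List (Act Call State) := h.flatMap Done.acts

/-- Use positions as identifiers. -/
def number (as : List (Act Call State)) : List (Op Call State) := as.mapIdx fun i a => ⟨a, i⟩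

theorem number_concat (as : List (Act Call State)) (a : Act Call State) :
    number (as ++ [a]) = number as ++ [⟨a, as.length⟩] := by simp [number]

theorem map_number (as : List (Act Call State)) : (number as).map Op.toAct = as := by
  induction as using List.reverseRecOn with
  | nil => rfl
  | append_singleton as a ih => rw [number_concat, List.map_append, ih]; rfl

theorem id_lt_of_mem_number {as : List (Act Call State)} {o : Op Call State}
    (h : o ∈ number as) : o.id < as.length := by
  simp only [number, List.mem_mapIdx] at h
  obtain ⟨i, hi, rfl⟩ := h
  exact hi

/-- The configuration of the atomic machine after a history. -/
def histConfig (init : Fin N → Code × State) (h : List (Done Call State N)) :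
    AtomicConfig Code Call State N where
  thread := h.foldl (fun f d => Function.update f d.tx (TxCode.skip, d.st))
    (fun τ => (TxCode.tx (init τ).1, (init τ).2))
  log := number (histActs h)

/-- A history of uninterrupted executions of transactions that the shared object permits. -/
inductive Serial (M : Model Code Call State) (init : Fin N → Code × State) :
    List (Done Call State N) → Prop
  | nil : Serial M init []
  | snoc {h d c} : Serial M init h → d.tx ∉ h.map Done.tx →
      M.Run (init d.tx).1 (init d.tx).2 d.acts c d.st → M.fin c d.st →
      M.allowed (histActs h ++ d.acts) → Serial M init (h ++ [d])

theorem histConfig_concat (h : List (Done Call State N)) (d : Done Call State N) :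
    histConfig init (h ++ [d]) =
      ⟨Function.update (histConfig init h).thread d.tx (TxCode.skip, d.st),
        number (histActs h ++ d.acts)⟩ := by
  simp [histConfig, histActs]

theorem histConfig_thread_of_notMem {h : List (Done Call State N)} (hτ : τ ∉ h.map Done.tx) :
    (histConfig init h).thread τ = (TxCode.tx (init τ).1, (init τ).2) := by
  induction h using List.reverseRecOn with
  | nil => rfl
  | append_singleton h d ih =>
    simp only [List.map_append, List.map_cons, List.map_nil, List.mem_append, List.mem_singleton,
      not_or] at hτ
    rw [histConfig_concat, ← ih hτ.1]
    exact Function.update_of_ne hτ.2 _ _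

theorem histConfig_code_eq_skip {h : List (Done Call State N)} :
    ((histConfig init h).thread τ).1 = .skip ↔ τ ∈ h.map Done.tx := by
  induction h using List.reverseRecOn with
  | nil => simp [histConfig]
  | append_singleton h d ih =>
    simp only [List.map_append, List.map_cons, List.map_nil, List.mem_append, List.mem_singleton]
    rw [histConfig_concat, ← ih]
    by_cases hd : τ = d.tx
    · subst hd; simp
    · simp [hd]

/-- Permission for the whole log is enough, by prefix closure; the current length is a fresh
identifier because earlier operations are numbered by smaller positions. -/
theorem bigStep_of_run {c c' : Code} {σ σ' : State} {as l : List (Act Call State)}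
    (h : M.Run c σ as c' σ') (hf : M.fin c' σ') (ha : M.allowed (l ++ as)) :
    BigStep M c σ (number l) σ' (number (l ++ as)) := by
  induction as generalizing c σ l with
  | nil =>
    obtain ⟨rfl, rfl⟩ := h
    rw [List.append_nil]
    exact .fin hf
  | cons a as ih =>
    obtain ⟨rfl, c₁, h₁, h₂⟩ := h
    have hl : l ++ a :: as = (l ++ [a]) ++ as := by simp
    rw [hl] at ha ⊢
    refine .step h₁ (σ' := a.post) (id := l.length) ?_ ?_ ?_
    · rw [map_number]
      exact Model.allowed_of_append ha
    · exact fun o ho => (id_lt_of_mem_number ho).ne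
    · have := ih h₂ ha
      rwa [number_concat] at this

/-- The initial segments of a history are the successive configurations of an atomic trace. -/
theorem Serial.atomicStep {h : List (Done Call State N)} (hs : Serial M init h) :
    ∀ j < h.length, AtomicStep M (histConfig init (h.take j)) (histConfig init (h.take (j + 1))) := by
  induction hs with
  | nil => simp
  | @snoc h d c hs hd hr hf ha ih =>
    intro j hj
    rw [List.length_append, List.length_singleton] at hj
    rcases Nat.lt_succ_iff_lt_or_eq.1 hj with hj | rfl
    · rw [List.take_append_of_le_length hj.le, List.take_append_of_le_length (by omega)]
      exact ih j hj
    · rw [List.take_left' rfl, List.take_of_length_le (by simp), histConfig_concat]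
      exact .run (histConfig_thread_of_notMem hd) (bigStep_of_run hr hf ha)

theorem Serial.nodup {h : List (Done Call State N)} (hs : Serial M init h) :
    (h.map Done.tx).Nodup := by
  induction hs with
  | nil => simp
  | @snoc h d c hs hd hr hf ha ih =>
    rw [List.map_append]
    exact ih.append (by simp) (by simpa using hd)

theorem Serial.run {h : List (Done Call State N)} (hs : Serial M init h) :
    ∀ d ∈ h, ∃ c, M.Run (init d.tx).1 (init d.tx).2 d.acts c d.st ∧ M.fin c d.st := by
  induction hs with
  | nil => simp
  | @snoc h d c hs hd hr hf ha ih =>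
    intro d' hd'
    rw [List.mem_append, List.mem_singleton] at hd'
    rcases hd' with hd' | rfl
    · exact ih d' hd'
    · exact ⟨c, hr, hf⟩

theorem Serial.allowed {h : List (Done Call State N)} (hs : Serial M init h) :
    M.allowed (histActs h) := by
  cases hs with
  | nil => exact M.allowed_nil
  | snoc hs hd hr hf ha => simpa [histActs] using ha

/-- A trace with a serial history is simulated by the atomic machine. -/
theorem Trace.exists_simulatedBy {C E : Type*} {Step : C → E → C → Prop} {start : C}
    (π : Trace Step start) (view : C → Config Code Call State N)
    (H : ℕ → List (Done Call State N)) (h₀ : H 0 = [])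
    (hH : ∀ i < π.len, H i <+: H (i + 1)) (hs : Serial M init (H π.len))
    (hsim : ∀ i ≤ π.len, SimRel M init (view (π.state i)) (histConfig init (H i))) :
    ∃ πA : AtomicTrace M init, π.SimulatedBy view πA := by
  have hpre : ∀ i j, i ≤ j → j ≤ π.len → H i <+: H j := by
    intro i j hij
    induction j, hij using Nat.le_induction with
    | base => exact fun _ => List.prefix_rfl
    | succ j hij ih => exact fun hj => (ih (by omega)).trans (hH j hj)
  -- The atomic trace runs through the initial segments of the last history, and time `i` is sent to
  -- the length of `H i`, which is itself such a segment.
  refine ⟨⟨(H π.len).length, fun j => histConfig init ((H π.len).take j), fun _ => (),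
    by rw [List.take_zero]; rfl, hs.atomicStep⟩, fun i => (H i).length, by simp [h₀], rfl,
    fun i hi => (hH i hi).length_le, fun i hi => ?_⟩
  have := List.prefix_iff_eq_take.1 (hpre i π.len hi le_rfl)
  change SimRel M init (view (π.state i)) (histConfig init ((H π.len).take (H i).length))
  rw [← this]
  exact hsim i hi

/-! ### Simulation of single steps. -/

theorem CoreStep.committedActs_eq (h : CoreStep M X τ r Y) (hr : r ≠ .cmt) :
    committedActs Y.shared = committedActs X.shared := by
  cases h with
  | push hτ hmv hal => simp [committedActs]
  | unpush hτ hG hmv hal => simp [committedActs, hG]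
  | cmt => exact absurd rfl hr
  | _ => rfl

theorem CoreStep.code_of_ne_cmt (h : CoreStep M X τ r Y) (hr : r ≠ .cmt) :
    ∃ c, (Y.thread τ).code = .tx c := by
  cases h with
  | cmt => exact absurd rfl hr
  | _ => simp [Config.setThread]

theorem CoreStep.cmt_spec (h : CoreStep M X τ .cmt Y) :
    (∃ c, (X.thread τ).code = .tx c ∧ M.fin c (X.thread τ).loc) ∧
      (∀ e ∈ (X.thread τ).log, ¬ e.IsUnpushed) ∧
      Y = ⟨Function.update X.thread τ ⟨.skip, (X.thread τ).loc, []⟩,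
        commitShared (X.thread τ).log X.shared⟩ := by
  cases h with
  | cmt hτ hf hun hpl => simpa [hτ] using ⟨hf, hun⟩

/-- What a transaction does before it commits. -/
def Config.done (X : Config Code Call State N) (τ : Fin N) : Done Call State N :=
  ⟨τ, ownActs (X.thread τ).log, (X.thread τ).loc⟩

theorem SimRel.step_of_ne_cmt {A : AtomicConfig Code Call State N} (hs : SimRel M init X A)
    (h : CoreStep M X τ r Y) (hr : r ≠ .cmt) : SimRel M init Y A := by
  refine ⟨h.committedActs_eq hr ▸ hs.1, fun τ' => ?_⟩
  rw [hs.2 τ']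
  by_cases hτ : τ' = τ
  · subst hτ
    obtain ⟨c, hc⟩ := h.code_eq_tx
    obtain ⟨c', hc'⟩ := h.code_of_ne_cmt hr
    rw [hc, hc']
  · rw [h.thread_of_ne hτ]

theorem SimRel.skip_iff {A : AtomicConfig Code Call State N} (hs : SimRel M init X A)
    (τ : Fin N) : (A.thread τ).1 = .skip ↔ (X.thread τ).code = .skip := by
  rw [hs.2 τ]
  split <;> simp [*]

/-- All own operations are pushed, so they form the complete run of the transaction. Moving them
behind the committed part gives the inclusion in the extended serial log; the invariant after the
commit says that the committed part is allowed, and through the inclusion the serial log is allowed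
too. -/
theorem SimRel.step_cmt {h : List (Done Call State N)} (hs : SimRel M init X (histConfig init h))
    (hh : Serial M init h) (hX : Inv M init X) (hY : Inv M init Y)
    (hc : CoreStep M X τ .cmt Y) :
    SimRel M init Y (histConfig init (h ++ [X.done τ])) ∧ Serial M init (h ++ [X.done τ]) := by
  obtain ⟨⟨c, hcode, hf⟩, hun, rfl⟩ := hc.cmt_spec
  have hle : M.LogLE (committedActs (commitShared (X.thread τ).log X.shared))
      (histActs h ++ ownActs (X.thread τ).log) := by
    rw [ownActs_eq_map_pushedOps hun]
    refine (hX.order.commit_logLE hX.ids rfl).trans (Model.LogLE.append_right ?_ _)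
    have := hs.1
    rwa [show (histConfig init h).log = number (histActs h) from rfl, map_number] at this
  constructor
  · rw [histConfig_concat]
    refine ⟨by rw [map_number]; exact hle, fun τ' => ?_⟩
    by_cases hτ : τ' = τ
    · subst hτ
      simp [Config.done]
    · simpa [hτ, Config.done] using hs.2 τ'
  · refine .snoc hh ?_ (hX.exec.exec τ c hcode).run hf
      (hle.allowed (hY.order.allowed_committed hY.ids hY.allowed))
    rw [← histConfig_code_eq_skip (init := init), hs.skip_iff]
    simp [Config.done, hcode]

theorem SimRel.start : SimRel M init (Config.start init) (histConfig init []) :=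
  ⟨Model.LogLE.refl _, fun _ => rfl⟩

theorem exists_seq {α : Type*} {P : ℕ → α → Prop} {Q : α → α → Prop} {n : ℕ} {a₀ : α}
    (h₀ : P 0 a₀) (hs : ∀ i < n, ∀ a, P i a → ∃ b, P (i + 1) b ∧ Q a b) :
    ∃ H : ℕ → α, H 0 = a₀ ∧ (∀ i ≤ n, P i (H i)) ∧ ∀ i < n, Q (H i) (H (i + 1)) := by
  induction n with
  | zero => exact ⟨fun _ => a₀, rfl, fun i hi => by rwa [Nat.le_zero.1 hi], by simp⟩
  | succ n ih =>
    obtain ⟨H, hH₀, hP, hQ⟩ := ih fun i hi => hs i (by omega)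
    obtain ⟨b, hb, hb'⟩ := hs n (by omega) _ (hP n le_rfl)
    refine ⟨fun i => if i ≤ n then H i else b, by simpa using hH₀, fun i hi => ?_, fun i hi => ?_⟩
    · by_cases h : i ≤ n
      · simpa [h] using hP i h
      · obtain rfl : i = n + 1 := by omega
        simpa using hb
    · by_cases h : i < n
      · simpa [h.le, Nat.succ_le_of_lt h] using hQ i h
      · obtain rfl : i = n := by omega
        simpa using hb'

end

section

variable {Code Call State Lock : Type*} {N : ℕ}
variable {M : Model Code Call State} {τ : Fin N} {r : Rule Call}
variable {init : Fin N → Code × State} {locks : Call → Set Lock}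

/-! ## Event logs -/

theorem pair_sublist_iff_getElem {α : Type*} {x y : α} {l : List α} :
    [x, y].Sublist l ↔ ∃ i j : ℕ, i < j ∧ l[i]? = some x ∧ l[j]? = some y := by
  induction l with
  | nil => simp
  | cons z l ih =>
    rw [pair_sublist_cons, ih]
    constructor
    · rintro (⟨rfl, h⟩ | ⟨i, j, hij, hi, hj⟩)
      · obtain ⟨j, hj⟩ := List.mem_iff_getElem?.1 h
        exact ⟨0, j + 1, by omega, by simp, by simpa using hj⟩
      · exact ⟨i + 1, j + 1, by omega, by simpa using hi, by simpa using hj⟩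
    · rintro ⟨i, j, hij, hi, hj⟩
      obtain ⟨j, rfl⟩ : ∃ k, j = k + 1 := ⟨j - 1, by omega⟩
      rw [List.getElem?_cons_succ] at hj
      cases i with
      | zero =>
        rw [List.getElem?_cons_zero, Option.some.injEq] at hi
        exact Or.inl ⟨hi.symm, List.mem_of_getElem? hj⟩
      | succ i =>
        rw [List.getElem?_cons_succ] at hi
        exact Or.inr ⟨i, j, by omega, hi, hj⟩

theorem pair_sublist_filterMap {α β : Type*} {f : α → Option β} {x y : β} {l : List α} :
    [x, y].Sublist (l.filterMap f) ↔
      ∃ a b, [a, b].Sublist l ∧ f a = some x ∧ f b = some y := by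
  constructor
  · induction l with
    | nil => simp
    | cons z l ih =>
      intro h
      have key : [x, y].Sublist (l.filterMap f) →
          ∃ a b, [a, b].Sublist (z :: l) ∧ f a = some x ∧ f b = some y := by
        intro h
        obtain ⟨a, b, hab, ha, hb⟩ := ih h
        exact ⟨a, b, hab.trans (List.sublist_cons_self _ _), ha, hb⟩
      cases hz : f z with
      | none =>
        rw [List.filterMap_cons_none hz] at h
        exact key h
      | some w =>
        rw [List.filterMap_cons_some hz, pair_sublist_cons] at h
        rcases h with ⟨rfl, h⟩ | h
        · obtain ⟨b, hb, hby⟩ := List.mem_filterMap.1 h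
          exact ⟨z, b, pair_sublist_cons.2 (Or.inl ⟨rfl, hb⟩), hz, hby⟩
        · exact key h
  · rintro ⟨a, b, hab, ha, hb⟩
    simpa [ha, hb] using hab.filterMap f

theorem pair_sublist_total {α : Type*} {x y : α} {l : List α} (hx : x ∈ l) (hy : y ∈ l)
    (hne : x ≠ y) : [x, y].Sublist l ∨ [y, x].Sublist l := by
  induction l with
  | nil => simp at hx
  | cons z l ih =>
    rw [List.mem_cons] at hx hy
    simp only [pair_sublist_cons]
    rcases hx with rfl | hx <;> rcases hy with rfl | hy
    · exact absurd rfl hne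
    · tauto
    · tauto
    · rcases ih hx hy <;> tauto

/-- The committed transactions in an event log, in the order of their commits. -/
def commits (E : List (Event Call Lock N)) : List (Fin N) :=
  E.filterMap fun e => match e.2 with
    | .commit => some e.1
    | _ => none

theorem precedes_commit_iff {E : List (Event Call Lock N)} {u v : Fin N} :
    Precedes E (u, .commit) (v, .commit) ↔ [u, v].Sublist (commits E) := by
  rw [Precedes, ← pair_sublist_iff_getElem, commits, pair_sublist_filterMap]
  have key : ∀ (e : Event Call Lock N) (w : Fin N), (match e.2 with
      | .commit => some e.1
      | _ => none) = some w ↔ e = (w, .commit) := by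
    rintro ⟨τ, k⟩ w
    cases k <;> simp
  constructor
  · exact fun h => ⟨_, _, h, rfl, rfl⟩
  · rintro ⟨a, b, h, ha, hb⟩
    rw [key] at ha hb
    exact ha ▸ hb ▸ h

/-! ## Invariants of the miner -/

theorem CoreStep.mem_ownOps {X Y : Config Code Call State N} (h : CoreStep M X τ r Y)
    {p : Code × Op Call State} (hp : p ∈ ownOps (Y.thread τ).log) :
    p ∈ ownOps (X.thread τ).log ∨ r = .app p.2.call := by
  cases h with
  | app hτ hs ha hf =>
    simp only [Config.setThread, Function.update_self, ownOps_append, ownOps_cons_unpushed,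
      ownOps_nil, List.mem_append, List.mem_singleton] at hp
    rcases hp with hp | rfl
    · exact Or.inl (by rwa [hτ])
    · exact Or.inr rfl
  | unapp hτ =>
    refine Or.inl ?_
    simp only [Config.setThread, Function.update_self] at hp
    simp [hτ, hp]
  | push hτ _ _ => exact Or.inl (by simpa [hτ] using hp)
  | unpush hτ _ _ _ => exact Or.inl (by simpa [hτ] using hp)
  | pull hτ _ _ _ _ => exact Or.inl (by simpa [hτ, Config.setThread] using hp)
  | unpull hτ _ => exact Or.inl (by simpa [hτ, Config.setThread] using hp)
  | cmt hτ _ _ _ => simp at hp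

/-- Locks are mutually exclusive, and cover the own operations of each transaction. -/
structure LockInv (locks : Call → Set Lock) (X : MinerConfig Code Call State Lock N)
    (E : List (Event Call Lock N)) : Prop where
  disj : ∀ τ τ', τ ≠ τ' → ∀ ℓ ∈ X.held τ, ℓ ∉ X.held τ'
  own : ∀ τ, ∀ p ∈ ownOps (X.cfg.thread τ).log, locks p.2.call ⊆ X.held τ
  event : ∀ τ, ∀ ℓ ∈ X.held τ, (τ, .lock ℓ) ∈ E

theorem LockInv.start : LockInv locks (MinerConfig.start (State := State) init) [] := by
  constructor <;> simp [MinerConfig.start, Config.start]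

/-- Operations that are not movers have calls with a common lock, which both transactions would be
holding. -/
theorem LockInv.pairSafe (hlocks : M.BoostingLocks locks)
    {X : MinerConfig Code Call State Lock N} {E : List (Event Call Lock N)}
    (h : LockInv locks X E) : PairSafe M X.cfg := by
  intro τ τ' hne o ho o' ho'
  by_contra hc
  obtain ⟨ℓ, h₁, h₂⟩ := hlocks o.toAct o'.toAct fun hc' => hc hc'.1
  obtain ⟨c, hc⟩ := mem_ownOps_of_mem_pushedOps ho
  obtain ⟨c', hc'⟩ := mem_ownOps_of_mem_pushedOps ho'
  exact h.disj τ τ' hne ℓ (h.own τ _ hc h₁) (h.own τ' _ hc' h₂)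

/-- Shared by commit and abort: locks are released only when no own operation is left that they
would have to cover. -/
theorem LockInv.of_release {X : MinerConfig Code Call State Lock N} {E E' : List (Event Call Lock N)}
    (hX : LockInv locks X E) {Y : Config Code Call State N} {active : Fin N → Bool}
    (hne : ∀ τ' ≠ τ, Y.thread τ' = X.cfg.thread τ') (hown : ownOps (Y.thread τ).log = [])
    (hE : E ⊆ E') : LockInv locks ⟨Y, Function.update X.held τ ∅, active⟩ E' where
  disj τ₁ τ₂ h ℓ h₁ h₂ := by
    by_cases hτ₁ : τ₁ = τ
    · subst hτ₁; simp at h₁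
    · by_cases hτ₂ : τ₂ = τ
      · subst hτ₂; simp at h₂
      · simp only [Function.update_of_ne hτ₁, Function.update_of_ne hτ₂] at h₁ h₂
        exact hX.disj τ₁ τ₂ h ℓ h₁ h₂
  own τ' p hp := by
    by_cases hτ : τ' = τ
    · subst hτ; simp [hown] at hp
    · simp only [hne τ' hτ] at hp
      simpa [hτ] using hX.own τ' p hp
  event τ' ℓ hℓ := by
    by_cases hτ : τ' = τ
    · subst hτ; simp at hℓ
    · simp only [Function.update_of_ne hτ] at hℓ
      exact hE (hX.event τ' ℓ hℓ)

theorem LockInv.of_core {X : MinerConfig Code Call State Lock N} {E E' : List (Event Call Lock N)}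
    (hX : LockInv locks X E) {Y : Config Code Call State N}
    (h : CoreStep M X.cfg τ r Y) (hr : ∀ m, r = .app m → locks m ⊆ X.held τ) (hE : E ⊆ E') :
    LockInv locks ⟨Y, X.held, X.active⟩ E' where
  disj := hX.disj
  own τ' p hp := by
    by_cases hτ : τ' = τ
    · subst hτ
      rcases h.mem_ownOps hp with hp | hp
      · exact hX.own τ' p hp
      · exact hr _ hp
    · simp only [h.thread_of_ne hτ] at hp
      exact hX.own τ' p hp
  event τ' ℓ hℓ := hE (hX.event τ' ℓ hℓ)

theorem LockInv.step {X Y : MinerConfig Code Call State Lock N} {E : List (Event Call Lock N)}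
    {ev : Option (Event Call Lock N)} (hX : LockInv locks X E) (h : MinerStep M locks X ev Y) :
    LockInv locks Y (E ++ ev.toList) := by
  have hE : E ⊆ E ++ ev.toList := List.subset_append_left _ _
  cases h with
  | begin _ _ => exact ⟨hX.disj, hX.own, fun τ ℓ hℓ => hE (hX.event τ ℓ hℓ)⟩
  | @lock τ ℓ ha hfree =>
    refine ⟨fun τ₁ τ₂ hne k h₁ h₂ => ?_, fun τ' p hp => ?_, fun τ' k hk => ?_⟩
    · by_cases hτ₁ : τ₁ = τ
      · subst hτ₁
        simp only [Function.update_self, Function.update_of_ne hne.symm] at h₁ h₂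
        rcases h₁ with rfl | h₁
        · exact hfree _ h₂
        · exact hX.disj _ _ hne k h₁ h₂
      · by_cases hτ₂ : τ₂ = τ
        · subst hτ₂
          simp only [Function.update_self, Function.update_of_ne hne] at h₁ h₂
          rcases h₂ with rfl | h₂
          · exact hfree _ h₁
          · exact hX.disj _ _ hne k h₁ h₂
        · simp only [Function.update_of_ne hτ₁, Function.update_of_ne hτ₂] at h₁ h₂
          exact hX.disj _ _ hne k h₁ h₂
    · by_cases hτ : τ' = τ
      · subst hτ
        simpa using (hX.own τ' p hp).trans (Set.subset_insert _ _)
      · simpa [hτ] using hX.own τ' p hp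
    · by_cases hτ : τ' = τ
      · subst hτ
        simp only [Function.update_self] at hk
        rcases hk with rfl | hk
        · simp
        · exact hE (hX.event τ' k hk)
      · simp only [Function.update_of_ne hτ] at hk
        exact hE (hX.event τ' k hk)
  | op ha hl hc => exact hX.of_core hc (fun m hm => by cases hm; exact hl) hE
  | silent ha hr hc => exact hX.of_core hc (fun m hm => by subst hm; exact hr.elim) hE
  | commit ha hc =>
    refine hX.of_release (fun _ => hc.thread_of_ne) ?_ hE
    rw [hc.cmt_spec.2.2]
    simp
  | abort ha hp => exact hX.of_release (fun _ _ => rfl) (ownOps_eq_nil_of_pulled hp) hE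

theorem MinerStep.cfg_cases {X Y : MinerConfig Code Call State Lock N}
    {ev : Option (Event Call Lock N)} (h : MinerStep M locks X ev Y) :
    (Y.cfg = X.cfg ∧ commits ev.toList = []) ∨
    (∃ τ r, CoreStep M X.cfg τ r Y.cfg ∧ r ≠ .cmt ∧ commits ev.toList = []) ∨
    ∃ τ, CoreStep M X.cfg τ .cmt Y.cfg ∧ commits ev.toList = [τ] := by
  cases h with
  | begin _ _ => exact Or.inl ⟨rfl, rfl⟩
  | lock _ _ => exact Or.inl ⟨rfl, rfl⟩
  | op _ _ hc => exact Or.inr (Or.inl ⟨_, _, hc, by simp, rfl⟩)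
  | silent _ hr hc => exact Or.inr (Or.inl ⟨_, _, hc, by rintro rfl; exact hr, rfl⟩)
  | commit _ hc => exact Or.inr (Or.inr ⟨_, hc, rfl⟩)
  | abort _ _ => exact Or.inl ⟨rfl, rfl⟩

theorem MinerStep.inv {X Y : MinerConfig Code Call State Lock N}
    {ev : Option (Event Call Lock N)} (h : MinerStep M locks X ev Y) (hX : Inv M init X.cfg)
    (hY : PairSafe M Y.cfg) : Inv M init Y.cfg := by
  rcases h.cfg_cases with ⟨h, _⟩ | ⟨τ, r, h, _⟩ | ⟨τ, h, _⟩
  · rwa [h]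
  · exact hX.step hY h
  · exact hX.step hY h

/-- The events emitted by the first `i` steps. -/
def MinerTrace.eventsBefore (π : MinerTrace M locks init) (i : ℕ) : List (Event Call Lock N) :=
  (List.range i).filterMap π.label

theorem MinerTrace.eventsBefore_succ (π : MinerTrace M locks init) (i : ℕ) :
    π.eventsBefore (i + 1) = π.eventsBefore i ++ (π.label i).toList := by
  rw [eventsBefore, List.range_succ, List.filterMap_append]
  cases h : π.label i <;> simp [h, eventsBefore]

theorem MinerTrace.inv (hlocks : M.BoostingLocks locks) (π : MinerTrace M locks init) :
    ∀ i ≤ π.len, Inv M init (π.state i).cfg ∧ LockInv locks (π.state i) (π.eventsBefore i) := by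
  intro i
  induction i with
  | zero =>
    intro _
    rw [π.state_zero]
    exact ⟨.start M init, .start⟩
  | succ i ih =>
    intro hi
    obtain ⟨h₁, h₂⟩ := ih (by omega)
    have hs := π.step i (by omega)
    have h₃ := h₂.step hs
    rw [← π.eventsBefore_succ] at h₃
    exact ⟨hs.inv h₁ (h₃.pairSafe hlocks), h₃⟩

/-- A history that accounts for the first `i` steps of a miner. -/
structure MinerHist (π : MinerTrace M locks init) (i : ℕ) (h : List (Done Call State N)) :
    Prop where
  sim : SimRel M init (π.state i).cfg (histConfig init h)
  serial : Serial M init h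
  commits_eq : commits (π.eventsBefore i) = h.map Done.tx
  locked : ∀ d ∈ h, ∀ a ∈ d.acts, ∀ ℓ ∈ locks a.call, (d.tx, .lock ℓ) ∈ π.eventsBefore i

/-- The history grows only at commits. At that moment the transaction still holds the locks of all
its operations, so the acquisitions are in the event log and remain known after the release. -/
theorem MinerTrace.exists_hist (hlocks : M.BoostingLocks locks) (π : MinerTrace M locks init) :
    ∃ H : ℕ → List (Done Call State N), H 0 = [] ∧ (∀ i ≤ π.len, MinerHist π i (H i)) ∧
      ∀ i < π.len, H i <+: H (i + 1) := by
  refine exists_seq ⟨?_, .nil, rfl, by simp⟩ ?_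
  · rw [π.state_zero]
    exact SimRel.start
  · intro i hi h hh
    obtain ⟨hX, hL⟩ := π.inv hlocks i hi.le
    obtain ⟨hY, -⟩ := π.inv hlocks (i + 1) hi
    have hcm : commits (π.eventsBefore (i + 1)) =
        h.map Done.tx ++ commits (π.label i).toList := by
      rw [π.eventsBefore_succ, ← hh.commits_eq]
      simp [commits]
    have hlk : ∀ d ∈ h, ∀ a ∈ d.acts, ∀ ℓ ∈ locks a.call,
        (d.tx, .lock ℓ) ∈ π.eventsBefore (i + 1) := fun d hd a ha ℓ hℓ => by
      rw [π.eventsBefore_succ]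
      exact List.mem_append_left _ (hh.locked d hd a ha ℓ hℓ)
    rcases (π.step i hi).cfg_cases with ⟨hs, hc⟩ | ⟨τ, r, hs, hr, hc⟩ | ⟨τ, hs, hc⟩
    · exact ⟨h, ⟨hs ▸ hh.sim, hh.serial, by rw [hcm, hc, List.append_nil], hlk⟩, List.prefix_rfl⟩
    · exact ⟨h, ⟨hh.sim.step_of_ne_cmt hs hr, hh.serial, by rw [hcm, hc, List.append_nil], hlk⟩,
        List.prefix_rfl⟩
    · obtain ⟨h₁, h₂⟩ := hh.sim.step_cmt hh.serial hX hY hs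
      refine ⟨_, ⟨h₁, h₂, by rw [hcm, hc]; simp [Config.done], ?_⟩, List.prefix_append _ _⟩
      intro d hd
      rw [List.mem_append, List.mem_singleton] at hd
      rcases hd with hd | rfl
      · exact hlk d hd
      · intro a ha ℓ hℓ
        obtain ⟨p, hp, rfl⟩ := List.mem_map.1 ha
        rw [π.eventsBefore_succ]
        exact List.mem_append_left _ (hL.event τ ℓ (hL.own τ p hp hℓ))

/-! ## The serial execution in commit order -/

/-- A serial execution of all transactions, in an order compatible with `hb`, such that
operations of transactions that are not related by `hb` commute. -/
structure Canon (M : Model Code Call State) (init : Fin N → Code × State)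
    (hb : Fin N → Fin N → Prop) where
  ord : List (Fin N)
  acts : Fin N → List (Act Call State)
  code : Fin N → Code
  st : Fin N → State
  nodup : ord.Nodup
  mem : ∀ τ, τ ∈ ord
  run : ∀ τ, M.Run (init τ).1 (init τ).2 (acts τ) (code τ) (st τ)
  fin : ∀ τ, M.fin (code τ) (st τ)
  allowed : M.allowed (ord.flatMap acts)
  order : ∀ u v, hb u v → [u, v].Sublist ord
  indep : ∀ u v, u ≠ v → ¬ hb u v → ¬ hb v u → ∀ a b : Act Call State,
    a.call ∈ (acts u).map Act.call → b.call ∈ (acts v).map Act.call → M.Commutes a b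

/-- The set of finished transactions is closed under predecessors. -/
def Config.Closed (hb : Fin N → Fin N → Prop) (X : Config Code Call State N) : Prop :=
  ∀ u v, hb u v → (X.thread v).code = .skip → (X.thread u).code = .skip

theorem MinerTrace.exists_canon (hlocks : M.BoostingLocks locks) (π : MinerTrace M locks init)
    (hM : π.final.cfg.Complete) {hb : Fin N → Fin N → Prop}
    (hhb : ∀ u v, hb u v ↔ HappensBefore π.eventLog u v) :
    Nonempty (Canon M init hb) ∧ (∀ i ≤ π.len, (π.state i).cfg.Closed hb) ∧
      ∃ πA : AtomicTrace M init, π.SimulatedBy MinerConfig.cfg πA := by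
  obtain ⟨H, h₀, hH, hpre⟩ := π.exists_hist hlocks
  have hlast := hH π.len le_rfl
  have hE : π.eventLog = π.eventsBefore π.len := rfl
  have hmem : ∀ i ≤ π.len, ∀ τ, ((π.state i).cfg.thread τ).code = .skip ↔
      τ ∈ (H i).map Done.tx := fun i hi τ => by
    rw [← (hH i hi).sim.skip_iff, histConfig_code_eq_skip]
  have hord : ∀ u v, hb u v → [u, v].Sublist ((H π.len).map Done.tx) := by
    intro u v h
    rw [← hlast.commits_eq, ← precedes_commit_iff, ← hE]
    exact ((hhb u v).1 h).1
  refine ⟨?_, ?_, ?_⟩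
  · have hall : ∀ τ, ∃ d ∈ H π.len, d.tx = τ := fun τ =>
      List.mem_map.1 ((hmem π.len le_rfl τ).1 (hM τ))
    choose D hD hDtx using hall
    have hmap : ∀ d ∈ H π.len, D d.tx = d := fun d hd =>
      List.inj_on_of_nodup_map hlast.serial.nodup (hD _) hd (hDtx _)
    have hrun := fun τ => hlast.serial.run (D τ) (hD τ)
    choose C hC using hrun
    refine ⟨⟨(H π.len).map Done.tx, fun τ => (D τ).acts, C, fun τ => (D τ).st,
      hlast.serial.nodup, fun τ => (hmem π.len le_rfl τ).1 (hM τ), fun τ => ?_,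
      fun τ => (hC τ).2, ?_, hord, ?_⟩⟩
    · have := (hC τ).1
      rwa [hDtx] at this
    · have : ((H π.len).map Done.tx).flatMap (fun τ => (D τ).acts) = histActs (H π.len) := by
        rw [histActs, List.flatMap_map]
        exact List.flatMap_congr fun d hd => by rw [hmap d hd]
      rw [this]
      exact hlast.serial.allowed
    · intro u v hne huv hvu a b ha hb'
      by_contra hc
      obtain ⟨ℓ, h₁, h₂⟩ := hlocks a b hc
      obtain ⟨a', ha', hae⟩ := List.mem_map.1 ha
      obtain ⟨b', hb', hbe⟩ := List.mem_map.1 hb'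
      have hu := hlast.locked _ (hD u) a' ha' ℓ (hae ▸ h₁)
      have hv := hlast.locked _ (hD v) b' hb' ℓ (hbe ▸ h₂)
      rw [hDtx, ← hE] at hu hv
      rcases pair_sublist_total ((hmem π.len le_rfl u).1 (hM u))
        ((hmem π.len le_rfl v).1 (hM v)) hne with h | h <;>
        rw [← hlast.commits_eq, ← precedes_commit_iff, ← hE] at h
      · exact huv ((hhb u v).2 ⟨h, ℓ, hu, hv⟩)
      · exact hvu ((hhb v u).2 ⟨h, ℓ, hv, hu⟩)
  · intro i hi u v huv hv
    rw [hmem i hi] at hv ⊢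
    have hp : H i <+: H π.len := by
      have : ∀ j, i ≤ j → j ≤ π.len → H i <+: H j := by
        intro j hij
        induction j, hij using Nat.le_induction with
        | base => exact fun _ => List.prefix_rfl
        | succ j hij ih => exact fun hj => (ih (by omega)).trans (hpre j hj)
      exact this _ hi le_rfl
    obtain ⟨t, ht⟩ := hp
    have hs := hord u v huv
    have hn := hlast.serial.nodup
    rw [← ht, List.map_append] at hs hn
    rcases pair_sublist_append.1 hs with h | h | h
    · exact (pair_sublist_mem h).1
    -- Each transaction commits once, so `v` cannot also occur after the initial segment.
    · exact absurd (pair_sublist_mem h).2 (List.disjoint_of_nodup_append hn hv)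
    · exact h.1
  · exact π.exists_simulatedBy MinerConfig.cfg H h₀ hpre hlast.serial fun i hi => (hH i hi).sim

end

section

variable {Code Call State Lock : Type*} {N : ℕ}
variable {M : Model Code Call State} {τ : Fin N} {r : Rule Call}
variable {init : Fin N → Code × State} {hb : Fin N → Fin N → Prop}

/-! ## Logs whose operations are tagged with their transactions -/

/-- The entries of a tagged log that belong to the transaction `u`. -/
def tagged {β : Type*} (u : Fin N) (G : List (Fin N × β)) : List β :=
  (G.filter fun x => x.1 = u).map Prod.snd

section Tagged

variable {β : Type*} {u v : Fin N} {G G' : List (Fin N × β)} {b : β}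

@[simp] theorem tagged_nil : tagged u ([] : List (Fin N × β)) = [] := rfl

@[simp] theorem tagged_append : tagged u (G ++ G') = tagged u G ++ tagged u G' := by
  simp [tagged]

@[simp] theorem tagged_cons_self : tagged u ((u, b) :: G) = b :: tagged u G := by simp [tagged]

theorem tagged_cons_of_ne (h : v ≠ u) : tagged u ((v, b) :: G) = tagged u G := by
  simp [tagged, h]

theorem tagged_map {γ : Type*} (f : β → γ) :
    tagged u (G.map (Prod.map id f)) = (tagged u G).map f := by
  simp [tagged, List.filter_map, Function.comp_def]

theorem mem_tagged : b ∈ tagged u G ↔ (u, b) ∈ G := by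
  simp [tagged]

end Tagged

namespace Canon

/-- A tagged log that arises from an execution compatible with `hb`, in which each transaction
follows the serial execution. -/
structure Good (cn : Canon M init hb) (G : List (Fin N × Act Call State)) : Prop where
  isPrefix : ∀ u, tagged u G <+: cn.acts u
  preds : ∀ x ∈ G, ∀ d, hb d x.1 → tagged d G = cn.acts d
  pairwise : G.Pairwise fun x y => ¬ hb y.1 x.1

variable (cn : Canon M init hb) {G : List (Fin N × Act Call State)}

theorem irrefl (cn : Canon M init hb) (u : Fin N) : ¬ hb u u := fun h =>
  pair_sublist_asymm cn.nodup (cn.order u u h) (cn.order u u h)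

theorem good_nil : cn.Good [] := ⟨by simp, by simp, by simp⟩

variable {cn}

theorem Good.concat (hG : cn.Good G) {u : Fin N} {a : Act Call State}
    (ha : tagged u G ++ [a] <+: cn.acts u) (hd : ∀ d, hb d u → tagged d G = cn.acts d)
    (hn : ∀ x ∈ G, ¬ hb u x.1) : cn.Good (G ++ [(u, a)]) := by
  have hne : ∀ d, d ≠ u → tagged d (G ++ [(u, a)]) = tagged d G := fun d h => by
    rw [tagged_append, tagged_cons_of_ne h.symm, tagged_nil, List.append_nil]
  refine ⟨fun v => ?_, fun x hx d hdx => ?_, ?_⟩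
  · by_cases hv : v = u
    · subst hv
      simpa using ha
    · rw [hne v hv]
      exact hG.isPrefix v
  · rw [List.mem_append, List.mem_singleton] at hx
    rcases hx with hx | rfl
    · rw [hne d (fun h => hn x hx (h ▸ hdx))]
      exact hG.preds x hx d hdx
    · rw [hne d (fun h => cn.irrefl u (by simpa [h] using hdx))]
      exact hd d hdx
  · refine List.pairwise_append.2 ⟨hG.pairwise, by simp, fun x hx y hy => ?_⟩
    rw [List.mem_singleton] at hy
    subst hy
    exact hn x hx

/-- Dropping the last operation does not make a predecessor incomplete: by `pairwise`, its
transaction precedes none of the transactions that occur earlier in the log. -/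
theorem Good.of_concat {x : Fin N × Act Call State} (hG : cn.Good (G ++ [x])) : cn.Good G := by
  obtain ⟨h₁, h₂, h₃⟩ := hG
  rw [List.pairwise_append] at h₃
  refine ⟨fun u => (List.prefix_append _ _).trans (tagged_append ▸ h₁ u), fun y hy d hd => ?_, h₃.1⟩
  have hne : x.1 ≠ d := fun h => h₃.2.2 y hy x (by simp) (h ▸ hd)
  have := h₂ y (by simp [hy]) d hd
  obtain ⟨v, a⟩ := x
  rwa [tagged_append, tagged_cons_of_ne hne, tagged_nil, List.append_nil] at this

/-- Such a log can be completed to one that is equivalent to the serial execution. -/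
theorem Good.exists_rest (hG : cn.Good G) : ∃ R : Fin N → List (Act Call State),
    (∀ u, cn.acts u = tagged u G ++ R u) ∧
    M.LogLE (cn.ord.flatMap cn.acts) (G.map Prod.snd ++ cn.ord.flatMap R) ∧
    M.LogLE (G.map Prod.snd ++ cn.ord.flatMap R) (cn.ord.flatMap cn.acts) := by
  induction G using List.reverseRecOn with
  | nil => exact ⟨cn.acts, by simp, Model.LogLE.refl _, Model.LogLE.refl _⟩
  | append_singleton G x ih =>
    obtain ⟨u, a⟩ := x
    obtain ⟨R, hR, h₁, h₂⟩ := ih hG.of_concat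
    obtain ⟨t, ht⟩ := hG.isPrefix u
    have hRu : R u = a :: t := by
      have := hR u
      rw [← ht, tagged_append, List.append_assoc, List.append_cancel_left_eq] at this
      simpa using this.symm
    obtain ⟨o₁, o₂, ho⟩ := List.append_of_mem (cn.mem u)
    have hn := cn.nodup
    rw [ho, List.nodup_middle, List.nodup_cons, List.mem_append, not_or] at hn
    have hne : ∀ d, d ≠ u → tagged d (G ++ [(u, a)]) = tagged d G := fun d h => by
      rw [tagged_append, tagged_cons_of_ne h.symm, tagged_nil, List.append_nil]
    -- To come next, `a` has to pass what remains of the transactions `d` before `u` in the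
    -- canonical order. There `u` cannot precede `d`; if `d` precedes `u`, it has already
    -- contributed in full and nothing of it remains; otherwise the two are independent.
    have hcom : ∀ x ∈ o₁.flatMap R, M.Commutes a x := by
      intro x hx
      obtain ⟨d, hd, hxd⟩ := List.mem_flatMap.1 hx
      have hdu : d ≠ u := fun h => hn.1.1 (h ▸ hd)
      refine cn.indep u d hdu.symm (fun h => ?_) (fun h => ?_) a x ?_ ?_
      · refine pair_sublist_asymm cn.nodup (cn.order u d h) ?_
        rw [ho]
        exact pair_sublist_append.2 (Or.inr (Or.inr ⟨hd, by simp⟩))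
      · have := hG.preds (u, a) (by simp) d h
        rw [hne d hdu, hR d] at this
        rw [List.self_eq_append_right.1 this] at hxd
        simp at hxd
      · rw [hR u, hRu]; simp
      · rw [hR d]
        exact List.mem_map_of_mem (List.mem_append_right _ hxd)
    have hup : ∀ o : List (Fin N), u ∉ o →
        o.flatMap (Function.update R u t) = o.flatMap R := fun o hu =>
      List.flatMap_congr fun d hd => by
        rw [Function.update_of_ne (show d ≠ u by rintro rfl; exact hu hd)]
    have hfl : cn.ord.flatMap R = o₁.flatMap R ++ a :: (t ++ o₂.flatMap R) := by
      rw [ho, List.flatMap_append, List.flatMap_cons, hRu, List.cons_append]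
    have hfl' : (G ++ [(u, a)]).map Prod.snd ++ cn.ord.flatMap (Function.update R u t) =
        G.map Prod.snd ++ a :: (o₁.flatMap R ++ (t ++ o₂.flatMap R)) := by
      rw [ho, List.flatMap_append, List.flatMap_cons, hup _ hn.1.1, hup _ hn.1.2,
        Function.update_self]
      simp
    rw [hfl] at h₁ h₂
    refine ⟨Function.update R u t, fun d => ?_, ?_, ?_⟩
    · by_cases hd : d = u
      · subst hd
        rw [hR d, hRu]; simp
      · rw [hne d hd, Function.update_of_ne hd]
        exact hR d
    · rw [hfl']
      exact h₁.trans (Model.logLE_move_front (fun x hx => (hcom x hx).2) _ _)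
    · rw [hfl']
      exact (Model.logLE_move_back (fun x hx => (hcom x hx).1) _ _).trans h₂

/-- The log is a prefix of its completion, which inherits permission from the canonical execution.
-/
theorem Good.allowed (hG : cn.Good G) : M.allowed (G.map Prod.snd) := by
  obtain ⟨R, -, h, -⟩ := hG.exists_rest
  exact Model.allowed_of_append (h.allowed cn.allowed)

theorem Good.logLE_of_full (hG : cn.Good G) (hf : ∀ u, tagged u G = cn.acts u) :
    M.LogLE (cn.ord.flatMap cn.acts) (G.map Prod.snd) ∧
      M.LogLE (G.map Prod.snd) (cn.ord.flatMap cn.acts) := by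
  obtain ⟨R, hR, h₁, h₂⟩ := hG.exists_rest
  have : cn.ord.flatMap R = [] := by
    rw [List.flatMap_eq_nil_iff]
    intro u _
    have := hR u
    rw [hf u] at this
    exact List.self_eq_append_right.1 this
  rw [this, List.append_nil] at h₁ h₂
  exact ⟨h₁, h₂⟩

/-- The next operation of a transaction is that of the serial execution. -/
theorem Good.eq_of_allowed {u : Fin N} {a b : Act Call State} (hG : cn.Good (G ++ [(u, b)]))
    (ha : M.allowed (G.map Prod.snd ++ [a])) (hc : a.call = b.call) (hp : a.pre = b.pre) :
    a = b := by
  have hb' := hG.allowed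
  rw [List.map_append] at hb'
  obtain ⟨m, σ, σ₁⟩ := a
  obtain ⟨m', σ', σ₂⟩ := b
  simp only at hc hp
  subst hc hp
  rw [M.allowed_det ha hb']

/-! ## Atomic traces compatible with `hb` -/

/-- The list `as` is what remains of the canonical run. Determinism of code gives the same next
call, `Good.eq_of_allowed` the same operation, and `fin` excluding a call makes both runs stop
together. -/
theorem Good.bigStep {u : Fin N} {c : Code} {σ σ' : State} {l l' : List (Op Call State)}
    (h : BigStep M c σ l σ' l') {G : List (Fin N × Act Call State)} (hG : cn.Good G)
    (hl : l.map Op.toAct = G.map Prod.snd) {as : List (Act Call State)}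
    (has : tagged u G ++ as = cn.acts u) (hr : M.Run c σ as (cn.code u) (cn.st u))
    (hd : ∀ d, hb d u → tagged d G = cn.acts d) (hn : ∀ x ∈ G, ¬ hb u x.1) :
    σ' = cn.st u ∧ ∃ G', cn.Good G' ∧ l'.map Op.toAct = G'.map Prod.snd ∧
      tagged u G' = cn.acts u ∧ ∀ d ≠ u, tagged d G' = tagged d G := by
  induction h generalizing G as with
  | fin hf =>
    obtain rfl := hr.eq_nil_of_fin hf
    exact ⟨hr.2, G, hG, hl, by simpa using has, fun _ _ => rfl⟩
  | @step c σ l m c' σ₁ id σ'' l'' hs ha hid hbig ih =>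
    cases as with
    | nil =>
      obtain ⟨rfl, rfl⟩ := hr
      exact absurd hs (M.fin_not_step (cn.fin u))
    | cons b as =>
      obtain ⟨hbp, c₁, hs', hr'⟩ := hr
      obtain ⟨rfl, rfl⟩ := M.step_det hs hs'
      have hG' : cn.Good (G ++ [(u, b)]) :=
        hG.concat ⟨as, by rw [← has]; simp⟩ hd hn
      have hab : (⟨b.call, σ, σ₁⟩ : Act Call State) = b :=
        hG'.eq_of_allowed (hl ▸ ha) rfl hbp.symm
      have hne : ∀ d, d ≠ u → tagged d (G ++ [(u, b)]) = tagged d G := fun d h => by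
        rw [tagged_append, tagged_cons_of_ne h.symm, tagged_nil, List.append_nil]
      have hσ : σ₁ = b.post := congrArg Act.post hab
      subst hσ
      have hl' : (l ++ [(⟨⟨b.call, σ, b.post⟩, id⟩ : Op Call State)]).map Op.toAct =
          (G ++ [(u, b)]).map Prod.snd := by
        rw [List.map_append, List.map_append, hl]
        simp only [List.map_cons, List.map_nil, hab]
      have hd' : ∀ d, hb d u → tagged d (G ++ [(u, b)]) = cn.acts d := by
        intro d hdu
        rw [hne d (fun h => cn.irrefl u (by simpa [h] using hdu))]
        exact hd d hdu
      have hn' : ∀ x ∈ G ++ [(u, b)], ¬ hb u x.1 := by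
        intro x hx
        rw [List.mem_append, List.mem_singleton] at hx
        rcases hx with hx | rfl
        · exact hn x hx
        · exact cn.irrefl u
      obtain ⟨h₁, G', h₂, h₃, h₄, h₅⟩ :=
        ih hG' hl' (as := as) (by rw [← has]; simp) hr' hd' hn'
      exact ⟨h₁, G', h₂, h₃, h₄, fun d hd => (h₅ d hd).trans (hne d hd)⟩

/-- Closure of the finished transactions under predecessors means that a transaction runs after all
its predecessors and before all its successors. The log therefore stays good, and at the end it is
full. -/
theorem atomic_final (cn : Canon M init hb) (π : AtomicTrace M init)
    (hcl : ∀ j ≤ π.len, ∀ u v, hb u v → ((π.state j).thread v).1 = .skip →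
      ((π.state j).thread u).1 = .skip) (hc : π.Complete) :
    M.LogLE (cn.ord.flatMap cn.acts) (π.final.log.map Op.toAct) ∧
      M.LogLE (π.final.log.map Op.toAct) (cn.ord.flatMap cn.acts) ∧
      ∀ τ, (π.final.thread τ).2 = cn.st τ := by
  have key : ∀ j ≤ π.len, ∃ G, cn.Good G ∧
      (π.state j).log.map Op.toAct = G.map Prod.snd ∧ ∀ τ,
      ((π.state j).thread τ = (.tx (init τ).1, (init τ).2) ∧ tagged τ G = []) ∨
      ((π.state j).thread τ = (.skip, cn.st τ) ∧ tagged τ G = cn.acts τ) := by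
    intro j
    induction j with
    | zero =>
      intro _
      refine ⟨[], cn.good_nil, ?_, fun τ => Or.inl ⟨?_, rfl⟩⟩ <;> rw [π.state_zero] <;> rfl
    | succ j ih =>
      intro hj
      obtain ⟨G, hG, hl, hth⟩ := ih (by omega)
      have hcl₀ := hcl j (by omega)
      have hcl₁ := hcl (j + 1) hj
      have hs : AtomicStep M (π.state j) (π.state (j + 1)) := π.step j (by omega)
      generalize π.state (j + 1) = A' at *
      cases hs with
      | @run u c σ σ' l' hu hbig =>
        have hfull : ∀ d, ((π.state j).thread d).1 = .skip → tagged d G = cn.acts d := by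
          intro d hd
          rcases hth d with ⟨h, _⟩ | ⟨_, h⟩
          · rw [h] at hd; simp at hd
          · exact h
        obtain ⟨h₁, h₂⟩ : (π.state j).thread u = (.tx (init u).1, (init u).2) ∧
            tagged u G = [] := by
          rcases hth u with h | ⟨h, _⟩
          · exact h
          · rw [h] at hu; simp at hu
        rw [hu] at h₁
        simp only [Prod.mk.injEq, TxCode.tx.injEq] at h₁
        obtain ⟨rfl, rfl⟩ := h₁
        have hd : ∀ d, hb d u → tagged d G = cn.acts d := by
          intro d hd
          have hdu : d ≠ u := fun h => cn.irrefl u (by simpa [h] using hd)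
          have := hcl₁ d u hd (by simp)
          simp only [Function.update_of_ne hdu] at this
          exact hfull d this
        -- A transaction that has contributed is finished; if `u` preceded it, `u` would be finished
        -- as well.
        have hn : ∀ x ∈ G, ¬ hb u x.1 := by
          intro x hx hux
          have hsk : ((π.state j).thread x.1).1 = .skip := by
            rcases hth x.1 with ⟨_, h⟩ | ⟨h, _⟩
            · have : x.2 ∈ tagged x.1 G := mem_tagged.2 hx
              rw [h] at this
              simp at this
            · rw [h]
          have := hcl₀ u x.1 hux hsk
          rw [hu] at this
          simp at this
        obtain ⟨rfl, G', hG', hl', hu', hne'⟩ := Good.bigStep hbig hG hl (u := u)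
          (as := cn.acts u) (by simp [h₂]) (cn.run u) hd hn
        refine ⟨G', hG', hl', fun τ => ?_⟩
        by_cases hτ : τ = u
        · subst hτ
          exact Or.inr ⟨by simp, hu'⟩
        · simp only [Function.update_of_ne hτ, hne' τ hτ]
          exact hth τ
  obtain ⟨G, hG, hl, hth⟩ := key π.len le_rfl
  have hall : ∀ τ, π.final.thread τ = (.skip, cn.st τ) ∧ tagged τ G = cn.acts τ := by
    intro τ
    rcases hth τ with ⟨h, _⟩ | h
    · have := hc τ
      rw [Trace.final, h] at this
      simp at this
    · exact h
  obtain ⟨h₁, h₂⟩ := hG.logLE_of_full fun τ => (hall τ).2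
  rw [← hl] at h₁ h₂
  exact ⟨h₁, h₂, fun τ => by rw [(hall τ).1]⟩

end Canon

/-! ## Every configuration of a simulating atomic trace is matched -/

open Classical in
/-- The number of finished transactions. -/
noncomputable def AtomicConfig.skips (A : AtomicConfig Code Call State N) : ℕ :=
  (Finset.univ.filter fun τ => (A.thread τ).1 = .skip).card

theorem AtomicStep.skips_eq {A A' : AtomicConfig Code Call State N} (h : AtomicStep M A A') :
    A'.skips = A.skips + 1 := by
  classical
  cases h with
  | @run τ c σ σ' l' hτ hbig =>
    rw [AtomicConfig.skips, AtomicConfig.skips, ← Finset.card_insert_of_notMem (a := τ)]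
    · congr 1
      ext τ'
      by_cases h : τ' = τ <;> simp [h]
    · simp [hτ]

/-- A discrete intermediate value theorem. -/
theorem exists_eq_of_le_succ {f : ℕ → ℕ} {n : ℕ} (h₀ : f 0 = 0)
    (hf : ∀ i < n, f (i + 1) ≤ f i + 1) : ∀ j ≤ f n, ∃ i ≤ n, f i = j := by
  induction n with
  | zero => exact fun j hj => ⟨0, le_rfl, by omega⟩
  | succ n ih =>
    intro j hj
    by_cases h : j ≤ f n
    · obtain ⟨i, hi, rfl⟩ := ih (fun i hi => hf i (by omega)) j h
      exact ⟨i, by omega, rfl⟩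
    · exact ⟨n + 1, le_rfl, by have := hf n (by omega); omega⟩

/-- An atomic step finishes exactly one transaction and a concurrent step at most one, so the map
between the traces cannot skip an atomic configuration. Properties of the finished set thus transfer
to every atomic configuration, not only to those in the image of an arbitrary map. -/
theorem Trace.SimulatedBy.exists_simRel {C E : Type*} {Step : C → E → C → Prop} {start : C}
    {π : Trace Step start} {view : C → Config Code Call State N} {πA : AtomicTrace M init}
    (h : π.SimulatedBy view πA)
    (hstep : ∀ i < π.len, ∃ τ, ∀ τ' ≠ τ,
      ((view (π.state (i + 1))).thread τ').code = .skip →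
      ((view (π.state i)).thread τ').code = .skip) :
    ∀ j ≤ πA.len, ∃ i ≤ π.len, SimRel M init (view (π.state i)) (πA.state j) := by
  classical
  obtain ⟨f, hf₀, hfn, hmono, hsim⟩ := h
  have hskips : ∀ j ≤ πA.len, (πA.state j).skips = j := by
    intro j
    induction j with
    | zero =>
      intro _
      rw [πA.state_zero]
      simp [AtomicConfig.skips, AtomicConfig.start]
    | succ j ih =>
      intro hj
      rw [AtomicStep.skips_eq (πA.step j (by omega)), ih (by omega)]
  have hle : ∀ i ≤ π.len, f i ≤ πA.len := by
    intro i hi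
    rw [← hfn]
    have : ∀ k, i ≤ k → k ≤ π.len → f i ≤ f k := by
      intro k hk
      induction k, hk using Nat.le_induction with
      | base => exact fun _ => le_rfl
      | succ k hk ih => exact fun hj => (ih (by omega)).trans (hmono k (by omega))
    exact this _ hi le_rfl
  have hsucc : ∀ i < π.len, f (i + 1) ≤ f i + 1 := by
    intro i hi
    obtain ⟨τ, hτ⟩ := hstep i hi
    rw [← hskips _ (hle (i + 1) hi), ← hskips _ (hle i hi.le)]
    refine le_trans (Finset.card_le_card (t := insert τ (Finset.univ.filter fun τ =>
      ((πA.state (f i)).thread τ).1 = .skip)) fun τ' h' => ?_) (Finset.card_insert_le _ _)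
    simp only [Finset.mem_filter, Finset.mem_univ, true_and, Finset.mem_insert,
      (hsim _ hi.le).skip_iff, (hsim (i + 1) hi).skip_iff] at h' ⊢
    by_cases h : τ' = τ
    · exact Or.inl h
    · exact Or.inr (hτ τ' h h')
  intro j hj
  obtain ⟨i, hi, rfl⟩ := exists_eq_of_le_succ hf₀ hsucc j (hfn ▸ hj)
  exact ⟨i, hi, hsim i hi⟩

end

section

variable {Code Call State Lock : Type*} {N : ℕ}
variable {M : Model Code Call State} {X Y : Config Code Call State N} {τ : Fin N} {r : Rule Call}
variable {init : Fin N → Code × State} {hb : Fin N → Fin N → Prop}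

/-! ## Validators -/

/-- The predecessors of each transaction that has started are finished. -/
def Config.PredsDone (hb : Fin N → Fin N → Prop) (X : Config Code Call State N) : Prop :=
  ∀ d u, hb d u → ((X.thread u).log ≠ [] ∨ (X.thread u).code = .skip) →
    (X.thread d).code = .skip

theorem Config.PredsDone.closed (h : X.PredsDone hb) : X.Closed hb :=
  fun u v huv hv => h u v huv (Or.inr hv)

theorem Config.PredsDone.start : (Config.start (Call := Call) init).PredsDone hb := by
  intro d u _ h
  simp [Config.start] at h

theorem Config.PredsDone.step (hX : X.PredsDone hb)
    (hpre : ∀ d, hb d τ → (X.thread d).code = .skip) (h : CoreStep M X τ r Y) :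
    Y.PredsDone hb := by
  intro d u hdu hu
  have hd : (X.thread d).code = .skip := by
    by_cases huτ : u = τ
    · subst huτ
      exact hpre d hdu
    · rw [h.thread_of_ne huτ] at hu
      exact hX d u hdu hu
  obtain ⟨c, hc⟩ := h.code_eq_tx
  rw [h.thread_of_ne]
  · exact hd
  · rintro rfl
    simp [hc] at hd

theorem ne_nil_of_mem_pushedOps {L : List (LocalEntry Code Call State)} {o : Op Call State}
    (h : o ∈ pushedOps L) : L ≠ [] := by
  rintro rfl
  simp at h

/-- If pushed operations have calls of the serial execution, those of different transactions
commute. -/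
theorem Config.PredsDone.pairSafe (cn : Canon M init hb) (hX : X.PredsDone hb)
    (hE : ExecInv M init X) (hc : ∀ τ, ∀ o ∈ pushedOps (X.thread τ).log,
      o.call ∈ (cn.acts τ).map Act.call) : PairSafe M X := by
  -- If `u` preceded the started transaction `v`, it would be finished and its log empty.
  have hun : ∀ u v o o', o ∈ pushedOps (X.thread u).log → o' ∈ pushedOps (X.thread v).log →
      ¬ hb u v := by
    intro u v o o' ho ho' huv
    have := hE.skip u (hX u v huv (Or.inl (ne_nil_of_mem_pushedOps ho')))
    exact ne_nil_of_mem_pushedOps ho this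
  exact fun u v hne o ho o' ho' => (cn.indep u v hne (hun u v o o' ho ho')
    (hun v u o' o ho' ho) o.toAct o'.toAct (hc u o ho) (hc v o' ho')).1

theorem ExecInv.exists_code (hX : ExecInv M init X) {o : Op Call State}
    (ho : o ∈ pushedOps (X.thread τ).log) : ∃ c, (X.thread τ).code = .tx c := by
  cases h : (X.thread τ).code with
  | tx c => exact ⟨c, rfl⟩
  | skip => exact absurd (hX.skip τ h) (ne_nil_of_mem_pushedOps ho)

/-- The states in the validator may differ from the canonical ones, but the calls cannot, and
independence is a matter of calls. -/
theorem ExecInv.calls_of_static (hs : M.StaticCalls) (cn : Canon M init hb)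
    (hX : ExecInv M init X) {o : Op Call State} (ho : o ∈ pushedOps (X.thread τ).log) :
    o.call ∈ (cn.acts τ).map Act.call := by
  obtain ⟨c, hc⟩ := hX.exists_code ho
  refine (hs.calls_prefix (hX.exec τ c hc).run (cn.run τ) (cn.fin τ)).subset ?_
  obtain ⟨c', hc'⟩ := mem_ownOps_of_mem_pushedOps ho
  exact List.mem_map.2 ⟨o.toAct, List.mem_map.2 ⟨_, hc', rfl⟩, rfl⟩

/-- The shared log follows the serial execution: it can be tagged such that the pushed operations
of each transaction are an initial segment of its operations in the serial execution, and all of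
them once the transaction is finished. -/
def Follows (cn : Canon M init hb) (X : Config Code Call State N) : Prop :=
  ∃ T : List (Fin N × Op Call State), T.map Prod.snd = X.shared.map SharedEntry.op ∧
    cn.Good (T.map (Prod.map id Op.toAct)) ∧ ∀ τ,
      ((X.thread τ).code = .skip → (tagged τ T).map Op.toAct = cn.acts τ) ∧
      ((X.thread τ).code ≠ .skip → tagged τ T = pushedOps (X.thread τ).log)

theorem Follows.start (cn : Canon M init hb) : Follows cn (Config.start init) :=
  ⟨[], rfl, cn.good_nil, fun τ => ⟨fun h => by simp [Config.start] at h, fun _ => rfl⟩⟩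

theorem Follows.call_mem {cn : Canon M init hb} (h : Follows cn X) (hE : ExecInv M init X)
    {o : Op Call State} (ho : o ∈ pushedOps (X.thread τ).log) :
    o.call ∈ (cn.acts τ).map Act.call := by
  obtain ⟨T, -, hG, hT⟩ := h
  obtain ⟨c, hc⟩ := hE.exists_code ho
  rw [← (hT τ).2 (by simp [hc])] at ho
  have := hG.isPrefix τ
  rw [tagged_map] at this
  exact List.mem_map_of_mem (f := Act.call) (this.subset (List.mem_map_of_mem ho))

/-- Transactions that come after a running one have not contributed to the shared log. -/
theorem not_hb_of_mem_tag {T : List (Fin N × Op Call State)} (hX : X.PredsDone hb)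
    (hT : ∀ τ, (X.thread τ).code ≠ .skip → tagged τ T = pushedOps (X.thread τ).log)
    (hτ : (X.thread τ).code ≠ .skip) {x : Fin N × Op Call State} (hx : x ∈ T) :
    ¬ hb τ x.1 := by
  intro h
  by_cases hs : (X.thread x.1).code = .skip
  · exact hτ (hX τ x.1 h (Or.inr hs))
  · have hx' : x.2 ∈ tagged x.1 T := mem_tagged.2 hx
    rw [hT _ hs] at hx'
    exact hτ (hX τ x.1 h (Or.inl (ne_nil_of_mem_pushedOps hx')))

/-- The hypothesis `hcY` is for CMT: once the transaction is finished, nothing of its canonical run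
may remain. -/
theorem Follows.of_same {cn : Canon M init hb} (hX : Follows cn X)
    (hs : Y.shared.map SharedEntry.op = X.shared.map SharedEntry.op)
    (hne : ∀ τ' ≠ τ, Y.thread τ' = X.thread τ') (hcX : (X.thread τ).code ≠ .skip)
    (hcY : (Y.thread τ).code = .skip → ∀ as, (pushedOps (X.thread τ).log).map Op.toAct ++ as =
      cn.acts τ → as = [])
    (hp : (Y.thread τ).code ≠ .skip →
      pushedOps (Y.thread τ).log = pushedOps (X.thread τ).log) : Follows cn Y := by
  obtain ⟨T, hTs, hG, hT⟩ := hX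
  refine ⟨T, hTs.trans hs.symm, hG, fun τ' => ?_⟩
  by_cases hτ : τ' = τ
  · subst hτ
    have hTτ := (hT τ').2 hcX
    refine ⟨fun h => ?_, fun h => by rw [hTτ, hp h]⟩
    obtain ⟨as, has⟩ := hG.isPrefix τ'
    rw [tagged_map, hTτ] at has
    have := hcY h as has
    rw [this, List.append_nil] at has
    rw [hTτ, has]
  · rw [hne τ' hτ]
    exact hT τ'

theorem pushedOps_eq_nil {L : List (LocalEntry Code Call State)} (h : ∀ e ∈ L, ¬ e.IsPushed) :
    pushedOps L = [] := by
  rw [List.eq_nil_iff_forall_not_mem]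
  intro o ho
  obtain ⟨e, he, hp, -⟩ := mem_pushedOps.1 ho
  exact h e he hp

/-- With pushes in program order, the own operations before `o` are exactly those already pushed, an
initial segment of the canonical run. The canonical run thus passes through the code and state in
which `o` was executed, and determinism identifies its next operation with `o`, since the shared log
allows both. -/
theorem Follows.push_step {cn : Canon M init hb} (hF : Follows cn X) (hX : X.PredsDone hb)
    (hE : ExecInv M init X) (hpre : ∀ d, hb d τ → (X.thread d).code = .skip)
    {c c₀ : Code} {σ : State} {L₁ L₂ : List (LocalEntry Code Call State)} {o : Op Call State}
    (hτ : X.thread τ = ⟨.tx c, σ, L₁ ++ ⟨o, .unpushed c₀⟩ :: L₂⟩)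
    (hal : M.allowed (sharedActs X.shared ++ [o.toAct]))
    (h₁ : ∀ e ∈ L₁, ¬ e.IsUnpushed) (h₂ : ∀ e ∈ L₂, ¬ e.IsPushed)
    (hYt : Y.thread = Function.update X.thread τ ⟨.tx c, σ, L₁ ++ ⟨o, .pushed c₀⟩ :: L₂⟩)
    (hYs : Y.shared = X.shared ++ [⟨o, false⟩]) : Follows cn Y := by
  obtain ⟨T, hTs, hG, hT⟩ := hF
  have hcode : (X.thread τ).code ≠ .skip := by simp [hτ]
  have hTτ := (hT τ).2 hcode
  have hex := hE.exec τ c (by simp [hτ])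
  simp only [hτ, ownOps_append, ownOps_cons_unpushed, pushedOps_append, pushedOps_cons_unpushed,
    pushedOps_eq_nil h₂, List.append_nil] at hex hTτ
  obtain ⟨c₁, σ₁, hex₁, -, hopre, c₂, hstep, -⟩ := Model.exec_append.1 hex
  have hrun : M.Run (init τ).1 (init τ).2 ((pushedOps L₁).map Op.toAct) c₁ σ₁ := by
    rw [← ownActs_eq_map_pushedOps h₁]
    exact hex₁.run
  obtain ⟨as, has⟩ := hG.isPrefix τ
  rw [tagged_map, hTτ] at has
  -- What remains of the canonical run starts where `o` was executed; it is not empty, as the code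
  -- there still makes a call.
  have hrun' := hrun.append_right (has ▸ cn.run τ)
  cases as with
  | nil =>
    obtain ⟨rfl, rfl⟩ := hrun'
    exact absurd hstep (M.fin_not_step (cn.fin τ))
  | cons b as =>
    obtain ⟨hbpre, c₃, hstep', -⟩ := hrun'
    have hpreds : ∀ d, hb d τ → tagged d (T.map (Prod.map id Op.toAct)) = cn.acts d := by
      intro d hd
      rw [tagged_map]
      exact (hT d).1 (hpre d hd)
    have hnot : ∀ x ∈ T.map (Prod.map id Op.toAct), ¬ hb τ x.1 := by
      intro x hx
      obtain ⟨y, hy, rfl⟩ := List.mem_map.1 hx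
      exact not_hb_of_mem_tag hX (fun τ => (hT τ).2) hcode hy
    have hG' := hG.concat (u := τ) (a := b)
      ⟨as, by rw [tagged_map, hTτ, ← has]; simp⟩ hpreds hnot
    have hsnd : (T.map (Prod.map id Op.toAct)).map Prod.snd = sharedActs X.shared := by
      rw [sharedActs_eq_map, ← hTs, List.map_map, List.map_map]
      rfl
    have hob : o.toAct = b := hG'.eq_of_allowed (by rw [hsnd]; exact hal)
      (M.step_det hstep hstep').1 (by rw [hopre, hbpre])
    refine ⟨T ++ [(τ, o)], ?_, ?_, fun τ' => ?_⟩
    · rw [hYs, List.map_append, List.map_append, hTs]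
      rfl
    · rw [List.map_append]
      rw [← hob] at hG'
      exact hG'
    · rw [hYt]
      by_cases hne : τ' = τ
      · subst hne
        rw [Function.update_self]
        refine ⟨fun h => by simp at h, fun _ => ?_⟩
        simp [hTτ, pushedOps_eq_nil h₂]
      · rw [Function.update_of_ne hne, tagged_append, tagged_cons_of_ne (Ne.symm hne), tagged_nil,
          List.append_nil]
        exact hT τ'

/-- The withdrawn operation is the last one its transaction has pushed, so an initial segment is
left. No successor has contributed yet, so no predecessor that must be complete loses an operation.
-/
theorem Follows.unpush_step {cn : Canon M init hb} (hF : Follows cn X) (hX : X.PredsDone hb)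
    (hI : IdInv X) {c c₀ : Code} {σ : State} {L₁ L₂ : List (LocalEntry Code Call State)}
    {o : Op Call State} {G₁ G₂ : List (SharedEntry Call State)}
    (hτ : X.thread τ = ⟨.tx c, σ, L₁ ++ ⟨o, .pushed c₀⟩ :: L₂⟩)
    (hGs : X.shared = G₁ ++ ⟨o, false⟩ :: G₂) (h₂ : ∀ e ∈ L₂, ¬ e.IsPushed)
    (hYt : Y.thread = Function.update X.thread τ ⟨.tx c, σ, L₁ ++ ⟨o, .unpushed c₀⟩ :: L₂⟩)
    (hYs : Y.shared = G₁ ++ G₂) : Follows cn Y := by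
  obtain ⟨T, hTs, hG, hT⟩ := hF
  have hcode : (X.thread τ).code ≠ .skip := by simp [hτ]
  have hTτ := (hT τ).2 hcode
  simp only [hτ, pushedOps_append, pushedOps_cons_pushed, pushedOps_eq_nil h₂] at hTτ
  have hTn : (T.map Prod.snd).Nodup := hTs ▸ hI.nodup_op
  have hoT : (τ, o) ∈ T := mem_tagged.1 (by rw [hTτ]; simp)
  rw [hGs, List.map_append, List.map_cons, List.map_eq_append_iff] at hTs
  obtain ⟨T₁, T', rfl, hT₁, hT'⟩ := hTs
  rw [List.map_eq_cons_iff] at hT'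
  obtain ⟨x, T₂, rfl, hxo, hT₂⟩ := hT'
  obtain rfl : (τ, o) = x := List.inj_on_of_nodup_map hTn hoT (by simp) hxo.symm
  have hno : o ∉ T₁.map Prod.snd ++ T₂.map Prod.snd := by
    rw [List.map_append, List.map_cons, List.nodup_middle, List.nodup_cons] at hTn
    exact hTn.1
  have hnoT₂ : o ∉ tagged τ T₂ := fun h =>
    hno (List.mem_append_right _ (List.mem_map.2 ⟨_, mem_tagged.1 h, rfl⟩))
  have hsplit : tagged τ T₁ = pushedOps L₁ ∧ tagged τ T₂ = [] := by
    rw [tagged_append, tagged_cons_self] at hTτ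
    -- Otherwise the last operation tagged `τ`, which is `o`, would lie in `T₂`, and `o` would occur
    -- twice.
    have hlast : tagged τ T₂ = [] := by
      by_contra hne
      have := congrArg List.getLast? hTτ
      rw [List.getLast?_append_cons, List.getLast?_append_cons, List.getLast?_singleton,
        List.getLast?_cons_of_ne_nil hne] at this
      exact hnoT₂ (List.mem_of_getLast? this)
    rw [hlast] at hTτ
    exact ⟨List.append_cancel_right hTτ, hlast⟩
  have htag : ∀ d, d ≠ τ → tagged d (T₁ ++ T₂) = tagged d (T₁ ++ (τ, o) :: T₂) := fun d hd => by
    rw [tagged_append, tagged_append, tagged_cons_of_ne (Ne.symm hd)]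
  have hmap : ∀ d, tagged d ((T₁ ++ T₂).map (Prod.map id Op.toAct)) =
      (tagged d (T₁ ++ T₂)).map Op.toAct := fun d => tagged_map _
  refine ⟨T₁ ++ T₂, ?_, ⟨fun u => ?_, fun x hx d hd => ?_, ?_⟩, fun τ' => ?_⟩
  · rw [hYs, List.map_append, List.map_append, hT₁, hT₂]
  · have := hG.isPrefix u
    rw [tagged_map] at this
    rw [hmap]
    by_cases hu : u = τ
    · subst hu
      refine List.IsPrefix.trans ?_ this
      rw [tagged_append, tagged_append, tagged_cons_self, hsplit.2, List.append_nil,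
        List.map_append]
      exact List.prefix_append _ _
    · rwa [htag u hu]
  · obtain ⟨y, hy, rfl⟩ := List.mem_map.1 hx
    have hy' : y ∈ T₁ ++ (τ, o) :: T₂ :=
      (List.Sublist.append_left (List.sublist_cons_self _ _) _).subset hy
    have hdτ : d ≠ τ := by
      rintro rfl
      exact not_hb_of_mem_tag hX (fun τ => (hT τ).2) hcode hy' hd
    have := hG.preds _ (List.mem_map_of_mem hy') d hd
    rw [tagged_map] at this
    rw [hmap, htag d hdτ, this]
  · exact hG.pairwise.sublist
      ((List.Sublist.append_left (List.sublist_cons_self _ _) _).map _)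
  · rw [hYt]
    by_cases hne : τ' = τ
    · subst hne
      rw [Function.update_self]
      refine ⟨fun h => by simp at h, fun _ => ?_⟩
      simp [hsplit, pushedOps_eq_nil h₂]
    · rw [Function.update_of_ne hne, htag τ' hne]
      exact hT τ'

theorem Follows.step {cn : Canon M init hb} (hF : Follows cn X) (hX : X.PredsDone hb)
    (hI : Inv M init X) (hpre : ∀ d, hb d τ → (X.thread d).code = .skip)
    (hoX : X.PushedInOrder) (hoY : Y.PushedInOrder) (h : CoreStep M X τ r Y) :
    Follows cn Y := by
  have hne : ∀ τ' ≠ τ, Y.thread τ' = X.thread τ' := fun _ => h.thread_of_ne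
  have hcX : (X.thread τ).code ≠ .skip := by
    obtain ⟨c, hc⟩ := h.code_eq_tx
    simp [hc]
  replace hoX := hoX τ
  replace hoY := hoY τ
  cases h with
  | app hτ _ _ _ =>
    exact hF.of_same rfl hne hcX (by simp [Config.setThread]) (by simp [Config.setThread, hτ])
  | unapp hτ =>
    exact hF.of_same rfl hne hcX (by simp [Config.setThread]) (by simp [Config.setThread, hτ])
  | push hτ hmv hal =>
    simp only [hτ, Function.update_self] at hoX hoY
    rw [List.pairwise_append, List.pairwise_cons] at hoX hoY
    exact hF.push_step hX hI.exec hpre hτ hal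
      (fun e he hu => hoY.2.2 e he _ List.mem_cons_self hu ⟨_, rfl⟩)
      (fun e he => hoX.2.1.1 e he ⟨_, rfl⟩) rfl rfl
  | unpush hτ hG hmv hal =>
    simp only [Function.update_self] at hoY
    rw [List.pairwise_append, List.pairwise_cons] at hoY
    exact hF.unpush_step hX hI.ids hτ hG (fun e he => hoY.2.1.1 e he ⟨_, rfl⟩) rfl rfl
  | pull hτ _ _ _ _ =>
    exact hF.of_same rfl hne hcX (by simp [Config.setThread]) (by simp [Config.setThread, hτ])
  | unpull hτ _ =>
    exact hF.of_same rfl hne hcX (by simp [Config.setThread]) (by simp [Config.setThread, hτ])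
  | @cmt c σ L hτ hf hun hpl =>
    refine hF.of_same (map_op_commitShared _ _) hne hcX (fun _ as has => ?_) (by simp)
    have hrun := (hI.exec.exec τ c (by simp [hτ])).run
    change M.Run _ _ (ownActs (X.thread τ).log) _ _ at hrun
    rw [ownActs_eq_map_pushedOps (by simpa [hτ] using hun)] at hrun
    -- Everything own is pushed and the code is finished, so the canonical run cannot continue from
    -- here.
    exact (hrun.append_right (has ▸ cn.run τ)).eq_nil_of_fin (by simpa [hτ] using hf)

/-! ### Invariants and simulation along validator traces. -/

theorem ValidatorTrace.predsDone (π : ValidatorTrace M hb init) :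
    ∀ i ≤ π.len, (π.state i).PredsDone hb := by
  intro i
  induction i with
  | zero =>
    intro _
    rw [π.state_zero]
    exact Config.PredsDone.start
  | succ i ih =>
    intro hi
    have hs : ValidatorStep M hb (π.state i) (π.state (i + 1)) := π.step i (by omega)
    obtain ⟨hpre, h⟩ := hs
    exact (ih (by omega)).step hpre h

/-- There is no circularity: `PairSafe` after a step needs only `ExecInv` and `PredsDone`, which are
preserved without it. -/
theorem ValidatorTrace.inv_of_static (hs : M.StaticCalls) (cn : Canon M init hb)
    (π : ValidatorTrace M hb init) : ∀ i ≤ π.len, Inv M init (π.state i) := by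
  intro i
  induction i with
  | zero =>
    intro _
    rw [π.state_zero]
    exact .start M init
  | succ i ih =>
    intro hi
    have hst : ValidatorStep M hb (π.state i) (π.state (i + 1)) := π.step i (by omega)
    obtain ⟨hpre, h⟩ := hst
    have hE := (ih (by omega)).exec.step h
    exact (ih (by omega)).step
      ((π.predsDone _ hi).pairSafe cn hE fun _ _ ho => hE.calls_of_static hs cn ho) h

/-- The two invariants advance alternately: `Follows` after the step uses `Inv` only before it, then
supplies the calls for `PairSafe`, which in turn yields `Inv` after the step. -/
theorem ValidatorTrace.inv_of_inOrder (cn : Canon M init hb) (π : ValidatorTrace M hb init)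
    (ho : ∀ i ≤ π.len, (π.state i).PushedInOrder) :
    ∀ i ≤ π.len, Inv M init (π.state i) ∧ Follows cn (π.state i) := by
  intro i
  induction i with
  | zero =>
    intro _
    rw [π.state_zero]
    exact ⟨.start M init, .start cn⟩
  | succ i ih =>
    intro hi
    obtain ⟨hI, hF⟩ := ih (by omega)
    have hst : ValidatorStep M hb (π.state i) (π.state (i + 1)) := π.step i (by omega)
    obtain ⟨hpre, h⟩ := hst
    have hE := hI.exec.step h
    have hF' := hF.step (π.predsDone i (by omega)) hI hpre (ho i (by omega)) (ho _ hi) h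
    exact ⟨hI.step ((π.predsDone _ hi).pairSafe cn hE fun _ _ h => hF'.call_mem hE h) h, hF'⟩

theorem ValidatorTrace.exists_simulatedBy (π : ValidatorTrace M hb init)
    (hI : ∀ i ≤ π.len, Inv M init (π.state i)) :
    ∃ πA : AtomicTrace M init, π.SimulatedBy id πA := by
  obtain ⟨H, h₀, hH, hpre⟩ := exists_seq (n := π.len) (a₀ := ([] : List (Done Call State N)))
    (P := fun i h => SimRel M init (π.state i) (histConfig init h) ∧ Serial M init h)
    (Q := fun h h' => h <+: h')
    ⟨by rw [π.state_zero]; exact SimRel.start, .nil⟩ (by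
      rintro i hi h ⟨hsim, hser⟩
      have hst : ValidatorStep M hb (π.state i) (π.state (i + 1)) := π.step i hi
      obtain ⟨hpre, hc⟩ := hst
      rename_i τ r
      by_cases hr : r = .cmt
      · subst hr
        exact ⟨_, hsim.step_cmt hser (hI i hi.le) (hI _ hi) hc, List.prefix_append _ _⟩
      · exact ⟨h, ⟨hsim.step_of_ne_cmt hc hr, hser⟩, List.prefix_rfl⟩)
  exact Trace.exists_simulatedBy π id H h₀ hpre (hH _ le_rfl).2 fun i hi => (hH i hi).1

/-! ## Comparison of serial executions -/

/-- Serial traces that simulate traces compatible with `hb` have the same outcome. -/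
theorem Trace.SimulatedBy.atomic_final {C E : Type*} {Step : C → E → C → Prop} {start : C}
    {π : Trace Step start} {view : C → Config Code Call State N} {πA : AtomicTrace M init}
    (h : π.SimulatedBy view πA) (cn : Canon M init hb)
    (hstep : ∀ i < π.len, ∃ τ, ∀ τ' ≠ τ,
      ((view (π.state (i + 1))).thread τ').code = .skip →
      ((view (π.state i)).thread τ').code = .skip)
    (hcl : ∀ i ≤ π.len, (view (π.state i)).Closed hb) (hc : (view π.final).Complete) :
    πA.Complete ∧ M.LogLE (cn.ord.flatMap cn.acts) (πA.final.log.map Op.toAct) ∧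
      M.LogLE (πA.final.log.map Op.toAct) (cn.ord.flatMap cn.acts) ∧
      ∀ τ, (πA.final.thread τ).2 = cn.st τ := by
  have hcomp : πA.Complete := by
    obtain ⟨f, -, hfn, -, hsim⟩ := h
    intro τ
    have := hsim π.len le_rfl
    rw [hfn] at this
    exact (this.skip_iff τ).2 (hc τ)
  refine ⟨hcomp, cn.atomic_final πA (fun j hj u v huv hv => ?_) hcomp⟩
  obtain ⟨i, hi, hsim⟩ := h.exists_simRel hstep j hj
  rw [hsim.skip_iff] at hv ⊢
  exact hcl i hi u v huv hv

theorem CoreStep.skip_of_ne (h : CoreStep M X τ r Y) :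
    ∀ τ' ≠ τ, (Y.thread τ').code = .skip → (X.thread τ').code = .skip :=
  fun τ' hτ hs => by rwa [h.thread_of_ne hτ] at hs

theorem MinerStep.exists_skip_of_ne {locks : Call → Set Lock}
    {X Y : MinerConfig Code Call State Lock N} {ev : Option (Event Call Lock N)}
    (h : MinerStep M locks X ev Y) :
    ∃ τ, ∀ τ' ≠ τ, (Y.cfg.thread τ').code = .skip → (X.cfg.thread τ').code = .skip := by
  -- A step that leaves the threads unchanged finishes no transaction, so any index will do; the
  -- acting transaction shows that there is one.
  have hN : Nonempty (Fin N) := by cases h <;> exact ⟨‹Fin N›⟩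
  rcases h.cfg_cases with ⟨h, _⟩ | ⟨τ, r, h, _⟩ | ⟨τ, h, _⟩
  · exact ⟨hN.some, fun τ' _ hs => h ▸ hs⟩
  · exact ⟨τ, h.skip_of_ne⟩
  · exact ⟨τ, h.skip_of_ne⟩

end

end PushPull

open PushPull

/-! ### The main theorem: both serial outcomes are compared with the canonical one. -/

theorem mainTheorem1 {Code Call State Lock : Type*} {N : ℕ}
    (M : Model Code Call State)
    (locks : Call → Set Lock) (hlocks : M.BoostingLocks locks)
    (init : Fin N → Code × State)
    (hb : Fin N → Fin N → Prop)
    (πM : MinerTrace M locks init) (hM : πM.final.cfg.Complete)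
    (hhb : ∀ τ' τ, hb τ' τ ↔ HappensBefore πM.eventLog τ' τ)
    (πV : ValidatorTrace M hb init) (hV : πV.final.Complete) :
    (∀ πA πA' : AtomicTrace M init,
      πM.SimulatedBy MinerConfig.cfg πA → πV.SimulatedBy id πA' → πA.Equiv πA') ∧
    (∃ πA : AtomicTrace M init, πM.SimulatedBy MinerConfig.cfg πA) ∧
    ((M.StaticCalls ∨ ∀ i ≤ πV.len, (πV.state i).PushedInOrder) →
      ∃ πA' : AtomicTrace M init, πV.SimulatedBy id πA') := by
  obtain ⟨⟨cn⟩, hcl, hsim⟩ := πM.exists_canon hlocks hM hhb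
  refine ⟨fun πA πA' hA hA' => ?_, hsim, ?_⟩
  · obtain ⟨hc, h₁, h₂, h₃⟩ := hA.atomic_final cn
      (fun i hi => (πM.step i hi).exists_skip_of_ne) hcl hM
    obtain ⟨hc', h₁', h₂', h₃'⟩ := hA'.atomic_final cn (fun i hi => by
        have hs : ValidatorStep M hb (πV.state i) (πV.state (i + 1)) := πV.step i hi
        obtain ⟨_, h⟩ := hs
        exact ⟨_, h.skip_of_ne⟩)
      (fun i hi => (πV.predsDone i hi).closed) hV
    exact ⟨hc, hc', h₂.trans h₁', h₂'.trans h₁, fun τ => (h₃ τ).trans (h₃' τ).symm⟩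
  · rintro (hs | ho)
    · exact πV.exists_simulatedBy (πV.inv_of_static hs cn)
    · exact πV.exists_simulatedBy fun i hi => (πV.inv_of_inOrder cn ho i hi).1
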